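/- Identify $E^4$ with $\mathbb R^4\cong\mathbb C^2$ by $(x^1+ix^2,x^3+ix^4)$, with the Euclidean inner product, the complex structure $J$ with matrix $$L_i=\begin{pmatrix}0&-1&0&0\\1&0&0&0\\0&0&0&-1\\0&0&1&0\end{pmatrix}$$ and the symplectic form $\omega(v,w)=\langle Jv,w\rangle$. Let $\mathcal G$ be the group of affine isometries of $E^4$ preserving $\omega$. Put $\epsilon=\tfrac12(1,0,-i,0)^T$. Let $\Omega\subset\mathbb C$ be a simply connected domain with coordinate $z=x+iy$. For $\beta:\Omega\to\mathbb R$, a map $u:\Omega\to\mathbb C^4$ of the form $u=a\,\epsilon+b\,L_i\bar\epsilon$ with $a,b:\Omega\to\mathbb C$ smooth, and smooth $X:\Omega\to E^4$, consider the three equations $$(1)\ \ \Delta\beta=0,\qquad (2)\ \ \frac{\partial u}{\partial\bar z}=\frac12\frac{\partial\beta}{\partial z}L_i\bar u,\qquad (3)\ \ dX=e^{\beta L_i/2}(u\,dz+\bar u\,d\bar z).$$ A Lagrangian immersion is called Hamiltonian stationary if the first variation of its area vanishes in the direction of $-J\nabla h$ for every $h\in C_c^\infty(E^4,\mathbb R)$.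 As $\Omega$ is not compact, this is understood for all pieces $X(U)$, $U\subset\Omega$ open, and all $h$ such that $\{z\in U: X(z)\in\operatorname{supp}h\}$ is compact. A smooth map $X:\Omega\to E^4$ is called a weakly conformal solution with Lagrangian angle map $\beta$ if $|X_x|=|X_y|$, $\langle X_x,X_y\rangle=0$, $\omega(X_x,X_y)=0$ and $(dx^1+i\,dx^2)\wedge(dx^3+i\,dx^4)(X_x,X_y)=|X_x||X_y|e^{i\beta}$ on $\Omega$, and $X$ is Hamiltonian stationary on the open set where $dX\neq0$. **Theorem.** (i) A map $X:\Omega\to E^4$ is a smooth Hamiltonian stationary conformal Lagrangian immersion if and only if there are $\beta$ and $u=a\,\epsilon+b\,L_i\bar\epsilon$, with $u$ nowhere zero, that satisfy (1), (2) and (3). For all solutions $\beta$ of (1) and $u$ of (2), all $z_0\in\Omega$ and all $p\in E^4$, equation (3) has exactly one solution $X$ on $\Omega$ with $X(z_0)=p$. (ii) Let $\beta$ be harmonic on $\Omega$. Then $X$ is a weakly conformal solution with Lagrangian angle map $\beta$ if and only if there is $u=a\,\epsilon+b\,L_i\bar\epsilon$ satisfying (2) and (3). (iii) Let $\beta$ be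 harmonic on $\Omega$ and let $z_0\in\Omega$. The set $V$ of all $X:\Omega\to E^4$ with $X(z_0)=0$ that satisfy (3) for some solution $u=a\,\epsilon+b\,L_i\bar\epsilon$ of (2) is a real vector space. The weakly conformal solutions with Lagrangian angle map $\beta$ are exactly the maps $W+p$ with $W\in V$, $p\in E^4$; those with Lagrangian angle map $\beta+c$ for some constant $c\in\mathbb R$ form exactly the orbit $\mathcal G\cdot V=\{g\circ W: g\in\mathcal G,\ W\in V\}$. -/

import Mathlib

open scoped ContDiff

noncomputable section

namespace HSL

/-- Euclidean 4-space, with coordinates `(x¹, x², x³, x⁴)` indexed by `0, 1, 2, 3`. -/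
abbrev E4 := EuclideanSpace ℝ (Fin 4)

/-- The matrix `L_i` of the complex structure `J`. -/
def Li : Matrix (Fin 4) (Fin 4) ℝ :=
  !![0, -1, 0, 0;
     1, 0, 0, 0;
     0, 0, 0, -1;
     0, 0, 1, 0]

/-- The complex structure `J` on `E4`. -/
def J : E4 →ₗ[ℝ] E4 := Matrix.toEuclideanLin Li

/-- The symplectic form `ω(v, w) = ⟨J v, w⟩`, that is `dx¹ ∧ dx² + dx³ ∧ dx⁴`. -/
def omega (v w : E4) : ℝ := inner ℝ (J v) w

/-- The complex area form `(dx¹ + i dx²) ∧ (dx³ + i dx⁴)`. -/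
def dz1dz2 (v w : E4) : ℂ :=
  ((v 0 : ℂ) + Complex.I * (v 1 : ℂ)) * ((w 2 : ℂ) + Complex.I * (w 3 : ℂ))
    - ((w 0 : ℂ) + Complex.I * (w 1 : ℂ)) * ((v 2 : ℂ) + Complex.I * (v 3 : ℂ))

/-- The group of affine isometries of `E4` that preserve the symplectic form. -/
def symplecticIsometries : Subgroup (E4 ≃ᵃⁱ[ℝ] E4) where
  carrier := {g | ∀ v w : E4,
    omega (g.linearIsometryEquiv v) (g.linearIsometryEquiv w) = omega v w}
  mul_mem' := by
    intro a b ha hb v w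
    exact (ha _ _).trans (hb v w)
  one_mem' := by
    intro v w
    rfl
  inv_mem' := by
    intro a ha v w
    have h := ha (a.linearIsometryEquiv.symm v) (a.linearIsometryEquiv.symm w)
    simp only [LinearIsometryEquiv.apply_symm_apply] at h
    exact h.symm

/-! ### Derivatives in the coordinate `z = x + i y` -/

section Derivatives

variable {F : Type*} [NormedAddCommGroup F] [NormedSpace ℝ F]

/-- `∂f/∂x`. -/
def dx (f : ℂ → F) (z : ℂ) : F := fderiv ℝ f z 1

/-- `∂f/∂y`. -/
def dy (f : ℂ → F) (z : ℂ) : F := fderiv ℝ f z Complex.I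

end Derivatives

/-- `∂β/∂z = (∂β/∂x - i ∂β/∂y) / 2` for a real function `β`. -/
def dzReal (β : ℂ → ℝ) (z : ℂ) : ℂ := (1 / 2) * (((dx β z : ℝ) : ℂ) - Complex.I * ((dy β z : ℝ) : ℂ))

/-- `∂u/∂z̄ = (∂u/∂x + i ∂u/∂y) / 2` for a vector valued complex function `u`. -/
def dzbar (u : ℂ → Fin 4 → ℂ) (z : ℂ) : Fin 4 → ℂ :=
  (1 / 2 : ℂ) • (dx u z + Complex.I • dy u z)

/-! ### Lagrangian conformal maps, area and Hamiltonian variations -/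

/-- `X` is conformal up to the possible vanishing of its differential. -/
def IsWeaklyConformal (Ω : Set ℂ) (X : ℂ → E4) : Prop :=
  ∀ z ∈ Ω, ‖dx X z‖ = ‖dy X z‖ ∧ inner ℝ (dx X z) (dy X z) = 0

/-- The pull-back of the symplectic form by `X` vanishes. -/
def IsLagrangian (Ω : Set ℂ) (X : ℂ → E4) : Prop :=
  ∀ z ∈ Ω, omega (dx X z) (dy X z) = 0

/-- A smooth conformal Lagrangian immersion of `Ω` into `E4`. -/
structure IsConformalLagrangianImmersion (Ω : Set ℂ) (X : ℂ → E4) : Prop where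
  smooth : ContDiffOn ℝ ∞ X Ω
  immersion : ∀ z ∈ Ω, Function.Injective (fderiv ℝ X z)
  conformal : IsWeaklyConformal Ω X
  lagrangian : IsLagrangian Ω X

/-- The area of the piece `X(K)` of a parametrized surface (with multiplicity):
the integral of `|∂X/∂x ∧ ∂X/∂y|`. -/
def area (K : Set ℂ) (X : ℂ → E4) : ℝ :=
  ∫ z in K, Real.sqrt (‖dx X z‖ ^ 2 * ‖dy X z‖ ^ 2 - (inner ℝ (dx X z) (dy X z)) ^ 2)

/-- The Hamiltonian vector field `-J ∇h`. -/
def hamiltonianField (h : E4 → ℝ) (x : E4) : E4 := -J (gradient h x)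

/-- `Φ` is a smooth deformation of the identity of `E4` with initial velocity `V`;
the flow of `V` is one. -/
structure IsDeformation (V : E4 → E4) (Φ : ℝ → E4 → E4) : Prop where
  smooth : ContDiff ℝ ∞ (fun p : ℝ × E4 => Φ p.1 p.2)
  zero : ∀ x, Φ 0 x = x
  velocity : ∀ x, HasDerivAt (fun t => Φ t x) (V x) 0

/-- `X` is a critical point of the area under Hamiltonian variations: for each compactly supported
smooth `h` on `E4`, the first variation of area in the direction `-J ∇h` vanishes.
As `Ω` is not compact and `X` need not be injective or proper, this is asked
for the pieces `X(U)`, `U ⊆ Ω` open, of the immersed surface which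
the support of `h` meets in a compact part (so that the deformation is the identity near the ends
of the piece, and the area that varies is finite). -/
def IsHamiltonianStationary (Ω : Set ℂ) (X : ℂ → E4) : Prop :=
  ∀ h : E4 → ℝ, ContDiff ℝ ∞ h → HasCompactSupport h →
    ∀ U : Set ℂ, IsOpen U → U ⊆ Ω → IsCompact {z ∈ U | X z ∈ tsupport h} →
      ∀ Φ : ℝ → E4 → E4, IsDeformation (hamiltonianField h) Φ →
        HasDerivAt (fun t => area {z ∈ U | X z ∈ tsupport h} (fun z => Φ t (X z))) 0 0

/-- `β` is a Lagrangian angle map of the weakly conformal Lagrangian map `X`: if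
`∂X/∂x = r e₁`, `∂X/∂y = r e₃` with `r > 0` and `e₁, e₃` orthonormal, then
`dz¹ ∧ dz² (e₁, e₃) = exp(iβ)`; no condition where the differential of `X` vanishes. -/
def IsLagrangianAngle (Ω : Set ℂ) (β : ℂ → ℝ) (X : ℂ → E4) : Prop :=
  ∀ z ∈ Ω, dz1dz2 (dx X z) (dy X z)
    = (‖dx X z‖ : ℂ) * (‖dy X z‖ : ℂ) * Complex.exp (Complex.I * (β z : ℂ))

/-- `X` is a weakly conformal Hamiltonian stationary Lagrangian map on `Ω` with Lagrangian angle
map `β`; it is an immersion, and stationary, where its differential does not vanish. -/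
structure IsWeaklyConformalSolution (Ω : Set ℂ) (β : ℂ → ℝ) (X : ℂ → E4) : Prop where
  smooth : ContDiffOn ℝ ∞ X Ω
  conformal : IsWeaklyConformal Ω X
  lagrangian : IsLagrangian Ω X
  angle : IsLagrangianAngle Ω β X
  stationary : IsHamiltonianStationary {z ∈ Ω | fderiv ℝ X z ≠ 0} X

/-! ### The three linear equations -/

/-- `ε = (1, 0, -i, 0) / 2`. -/
def eps : Fin 4 → ℂ := (1 / 2 : ℂ) • ![1, 0, -Complex.I, 0]

/-- A real matrix acting on `ℂ⁴`. -/
def realAct (M : Matrix (Fin 4) (Fin 4) ℝ) (v : Fin 4 → ℂ) : Fin 4 → ℂ :=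
  (M.map (fun r : ℝ => (r : ℂ))).mulVec v

/-- `u = a ε + b L_i ε̄` on `Ω` for smooth complex functions `a`, `b`. -/
def IsSpinorField (Ω : Set ℂ) (u : ℂ → Fin 4 → ℂ) : Prop :=
  ∃ a b : ℂ → ℂ, ContDiffOn ℝ ∞ a Ω ∧ ContDiffOn ℝ ∞ b Ω ∧
    ∀ z ∈ Ω, u z = a z • eps + b z • realAct Li (star eps)

/-- First equation: `Δβ = 0` on `Ω`. -/
def Lin1 (Ω : Set ℂ) (β : ℂ → ℝ) : Prop := InnerProductSpace.HarmonicOnNhd β Ω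

/-- Second equation: `∂u/∂z̄ = (1/2) (∂β/∂z) L_i ū`, for `u = a ε + b L_i ε̄`. -/
def Lin2 (Ω : Set ℂ) (β : ℂ → ℝ) (u : ℂ → Fin 4 → ℂ) : Prop :=
  IsSpinorField Ω u ∧
    ∀ z ∈ Ω, dzbar u z = ((1 / 2 : ℂ) * dzReal β z) • realAct Li (star (u z))

/-- Third equation: `dX = exp(β L_i / 2) (u dz + ū dz̄)`, evaluated on each tangent vector `w`. -/
def Lin3 (Ω : Set ℂ) (β : ℂ → ℝ) (u : ℂ → Fin 4 → ℂ) (X : ℂ → E4) : Prop :=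
  ContDiffOn ℝ ∞ X Ω ∧
    ∀ z ∈ Ω, ∀ w : ℂ, (fun k => ((fderiv ℝ X z w) k : ℂ))
      = realAct (NormedSpace.exp ((β z / 2) • Li)) (w • u z + star w • star (u z))

end HSL

end

noncomputable section

namespace HSL

/-! Write κ for `kap`. In complex coordinates κ(z¹, z²) = (-z̄², z̄¹), an antilinear isometry with
κ² = -1, so J and κ make E⁴ a quaternionic line. For a ≠ 0 the vectors a, Ja, κa, Jκa form an
orthogonal basis, and the conformal, Lagrangian and angle conditions prescribe all four coefficients
of X_y in the basis built on a = X_x. Together they are the single equation X_y = e^{βJ} κ X_x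
(`conformal_lagrangian_angle_iff`, `HasAngle`). For fixed β it is real linear in X, whence the
vector space V.

Since κ anticommutes with J, e^{βJ} κ = e^{βJ/2} κ e^{-βJ/2}. With v = e^{-βJ/2} X_x the equation
becomes dX = e^{βJ/2}(v dx + κv dy). The vectors a ε + b L_i ε̄ form the i-eigenspace of the
complexified κ, so v = 2 Re u identifies them with E⁴ and turns v dx + κv dy into u dz + ū dz̄: this
is equation (3). Equation (2) says that its right-hand side is closed (`dzbar_eq_iff_closed`), and
on a simply connected domain closed forms have primitives.

Differentiating the angle equation gives ΔX = J dX(∇β). The first variation of area of a conformal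
immersion along W is ∫ ⟨∇X, ∇(W∘X)⟩ (`hasDerivAt_area`); for W = -J∇h, integration by parts turns it
into -∫ (h∘X) Δβ (`hasDerivAt_area_hamiltonian`). Hence harmonic β gives stationarity; conversely, h
is taken to be a bump at X(z₀) on a disc where X takes that value only at the centre.

An immersion has an angle because dz¹∧dz²(X_x, X_y)/|X_x|² has modulus one and lifts to an argument.
Symplectic isometries have unitary linear part, so they shift β by the argument of the determinant;
e^{tJ} shifts it by 2t, so every constant occurs. -/

/-! ### Quaternionic algebra on E⁴ and the angle equation -/

theorem J_apply (v : E4) : J v = !₂[-v 1, v 0, -v 3, v 2] := by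
  ext k
  fin_cases k <;> simp [J, Li, Matrix.toEuclideanLin, Matrix.mulVec, dotProduct, Fin.sum_univ_four]

/-- The complex structure `J` as a continuous linear map. -/
def JL : E4 →L[ℝ] E4 := J.toContinuousLinearMap

@[simp] theorem JL_apply (v : E4) : JL v = J v := rfl

/-- Right multiplication by the quaternion `j`, which anticommutes with `J`. -/
def kap : E4 →L[ℝ] E4 := LinearMap.toContinuousLinearMap
  { toFun := fun v => !₂[-v 2, v 3, v 0, -v 1]
    map_add' := by
      intro v w; ext k; fin_cases k <;> simp <;> ring
    map_smul' := by
      intro c v; ext k; fin_cases k <;> simp }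

theorem kap_apply (v : E4) : kap v = !₂[-v 2, v 3, v 0, -v 1] := rfl

theorem J_J (v : E4) : J (J v) = -v := by
  ext k; fin_cases k <;> simp [J_apply]

theorem kap_kap (v : E4) : kap (kap v) = -v := by
  ext k; fin_cases k <;> simp [kap_apply]

theorem kap_J (v : E4) : kap (J v) = -J (kap v) := by
  ext k; fin_cases k <;> simp [kap_apply, J_apply]

theorem inner_E4 (v w : E4) :
    inner ℝ v w = v 0 * w 0 + v 1 * w 1 + v 2 * w 2 + v 3 * w 3 := by
  simp [PiLp.inner_apply, Fin.sum_univ_four]; ring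

theorem norm_sq_E4 (v : E4) : ‖v‖ ^ 2 = v 0 ^ 2 + v 1 ^ 2 + v 2 ^ 2 + v 3 ^ 2 := by
  rw [← real_inner_self_eq_norm_sq, inner_E4]; ring

theorem inner_J_J (v w : E4) : inner ℝ (J v) (J w) = inner ℝ v w := by
  simp [inner_E4, J_apply]; ring

/-- The rotation `exp (t J)`. -/
def rot (t : ℝ) : E4 →L[ℝ] E4 := Real.cos t • ContinuousLinearMap.id ℝ E4 + Real.sin t • JL

theorem rot_apply (t : ℝ) (v : E4) : rot t v = Real.cos t • v + Real.sin t • J v := by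
  simp [rot]

theorem rot_add (s t : ℝ) (v : E4) : rot (s + t) v = rot s (rot t v) := by
  simp only [rot_apply, Real.cos_add, Real.sin_add, map_add, map_smul, J_J]
  module

theorem rot_zero (v : E4) : rot 0 v = v := by simp [rot_apply]

theorem rot_neg_rot (t : ℝ) (v : E4) : rot (-t) (rot t v) = v := by
  rw [← rot_add, neg_add_cancel, rot_zero]

theorem rot_rot_neg (t : ℝ) (v : E4) : rot t (rot (-t) v) = v := by
  rw [← rot_add, add_neg_cancel, rot_zero]

theorem kap_rot (t : ℝ) (v : E4) : kap (rot t v) = rot (-t) (kap v) := by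
  simp only [rot_apply, map_add, map_smul, kap_J, Real.cos_neg, Real.sin_neg]
  module

theorem J_rot (t : ℝ) (v : E4) : J (rot t v) = rot t (J v) := by
  simp only [rot_apply, map_add, map_smul]

theorem inner_rot_rot (t : ℝ) (v w : E4) : inner ℝ (rot t v) (rot t w) = inner ℝ v w := by
  have h : inner ℝ v (J w) = - inner ℝ (J v) w := by
    rw [← inner_J_J v (J w), J_J, inner_neg_right]
  simp only [rot_apply, inner_add_left, inner_add_right, real_inner_smul_left,
    real_inner_smul_right, inner_J_J, h]
  linear_combination inner ℝ v w * Real.sin_sq_add_cos_sq t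

theorem norm_rot (t : ℝ) (v : E4) : ‖rot t v‖ = ‖v‖ := by
  rw [← sq_eq_sq₀ (norm_nonneg _) (norm_nonneg _), ← real_inner_self_eq_norm_sq, inner_rot_rot,
    real_inner_self_eq_norm_sq]

/-- The pairs `(a, b)` spanning, up to scale, an oriented Lagrangian plane with angle `θ` in a
conformal way are the pairs `(a, rot θ (kap a))`. -/
theorem conformal_lagrangian_angle_iff (a b : E4) (θ : ℝ) :
    (‖a‖ = ‖b‖ ∧ inner ℝ a b = 0 ∧ omega a b = 0 ∧
      dz1dz2 a b = (‖a‖ : ℂ) * (‖b‖ : ℂ) * Complex.exp (Complex.I * (θ : ℂ))) ↔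
    b = rot θ (kap a) := by
  have hexp : Complex.exp (Complex.I * (θ : ℂ)) = (Real.cos θ : ℂ) + Real.sin θ * Complex.I := by
    rw [mul_comm, Complex.exp_mul_I, Complex.ofReal_cos, Complex.ofReal_sin]
  constructor
  · rintro ⟨hn, hi, ho, hd⟩
    by_cases ha : ‖a‖ = 0
    · have hb : b = 0 := by rw [← norm_eq_zero, ← hn, ha]
      have ha : a = 0 := norm_eq_zero.1 ha
      simp [ha, hb]
    have hr : a 0 ^ 2 + a 1 ^ 2 + a 2 ^ 2 + a 3 ^ 2 ≠ 0 := by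
      rw [← norm_sq_E4]; exact pow_ne_zero 2 ha
    rw [← hn, hexp, ← Complex.ofReal_mul, ← pow_two, norm_sq_E4] at hd
    have hre := congrArg Complex.re hd
    have him := congrArg Complex.im hd
    simp [dz1dz2] at hre him
    norm_cast at hre him
    simp [omega, inner_E4, J_apply] at hi ho
    -- The four hypotheses are the inner products of b with a, Ja, κa and Jκa, the last two being
    -- the real and imaginary parts of `dz1dz2 a b`. Each coordinate below is the expansion of |a|²
    -- b in this orthogonal frame.
    ext k
    apply mul_left_cancel₀ hr
    fin_cases k <;> simp [rot_apply, kap_apply, J_apply, -mul_eq_mul_left_iff]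
    · linear_combination a 0 * hi - a 1 * ho - a 2 * hre - a 3 * him
    · linear_combination a 1 * hi + a 0 * ho - a 2 * him + a 3 * hre
    · linear_combination a 2 * hi - a 3 * ho + a 0 * hre + a 1 * him
    · linear_combination a 3 * hi + a 2 * ho + a 0 * him - a 1 * hre
  · rintro rfl
    have hk : ‖rot θ (kap a)‖ = ‖a‖ := by
      rw [norm_rot, ← sq_eq_sq₀ (norm_nonneg _) (norm_nonneg _), norm_sq_E4, norm_sq_E4]
      simp [kap_apply]; ring
    refine ⟨hk.symm, ?_, ?_, ?_⟩
    · simp [inner_E4, rot_apply, kap_apply, J_apply]; ring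
    · simp [omega, inner_E4, rot_apply, kap_apply, J_apply]; ring
    · rw [hk, hexp, ← Complex.ofReal_mul, ← pow_two, norm_sq_E4]
      apply Complex.ext <;> simp [dz1dz2, rot_apply, kap_apply, J_apply] <;> norm_cast <;> ring

/-! ### The matrix exponential and the spinor space -/

/-- As L_i² = -1, the map x + iy ↦ x + y L_i is a continuous algebra homomorphism from ℂ, and it
carries exp(it) = cos t + i sin t to the exponential of t L_i. -/
theorem exp_smul_Li (t : ℝ) :
    NormedSpace.exp (t • Li) = Real.cos t • (1 : Matrix (Fin 4) (Fin 4) ℝ) + Real.sin t • Li := by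
  have hL : Li * Li = -1 := by
    ext i j
    fin_cases i <;> fin_cases j <;> simp [Li, Matrix.mul_apply, Fin.sum_univ_four]
  let f : ℂ →ₐ[ℝ] Matrix (Fin 4) (Fin 4) ℝ := Complex.lift ⟨Li, hL⟩
  have hf (z : ℂ) : f z = z.re • (1 : Matrix (Fin 4) (Fin 4) ℝ) + z.im • Li := by
    simp [f, Complex.liftAux_apply, Algebra.algebraMap_eq_smul_one]
  have hc : Continuous f := by
    have : (f : ℂ → Matrix (Fin 4) (Fin 4) ℝ) = fun z => z.re • 1 + z.im • Li := funext hf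
    rw [this]; fun_prop
  let : NormedRing (Matrix (Fin 4) (Fin 4) ℝ) := Matrix.linftyOpNormedRing
  let : NormedAlgebra ℝ (Matrix (Fin 4) (Fin 4) ℝ) := Matrix.linftyOpNormedAlgebra
  have h := NormedSpace.map_exp (f : ℂ →+* Matrix (Fin 4) (Fin 4) ℝ) hc ((t : ℂ) * Complex.I)
  have h2 : f ((t : ℂ) * Complex.I) = t • Li := by simp [hf]
  have h3 : f (NormedSpace.exp ((t : ℂ) * Complex.I)) = NormedSpace.exp (f ((t : ℂ) * Complex.I)) := h
  rw [h2, hf, ← Complex.exp_eq_exp_ℂ, Complex.exp_ofReal_mul_I_re, Complex.exp_ofReal_mul_I_im] at h3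
  exact h3.symm

/-- The inclusion of real vectors in complex vectors. -/
def toC (v : E4) : Fin 4 → ℂ := fun k => ((v k : ℝ) : ℂ)

theorem toC_injective : Function.Injective toC := by
  intro v w h
  ext k
  exact Complex.ofReal_injective (congrFun h k)

theorem realAct_exp_toC (t : ℝ) (v : E4) :
    realAct (NormedSpace.exp (t • Li)) (toC v) = toC (rot t v) := by
  ext k
  rw [exp_smul_Li]
  fin_cases k <;>
    simp [realAct, toC, rot_apply, J_apply, Matrix.mulVec, dotProduct, Fin.sum_univ_four, Li,
      Matrix.one_apply]
  all_goals ring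

/-- The real vector `2 Re (a ε + b L_i ε̄)`. -/
def spin (a b : ℂ) : E4 := !₂[a.re, b.re, a.im, -b.im]

theorem eps_comb (a b : ℂ) : a • eps + b • realAct Li (star eps) =
    (1 / 2 : ℂ) • ![a, b, -Complex.I * a, Complex.I * b] := by
  ext k
  fin_cases k <;>
    simp [eps, realAct, Li, Matrix.mulVec, dotProduct, Fin.sum_univ_four, Complex.conj_ofNat] <;> ring

/-- Multiplication by i on these vectors is the complexified κ, so 2 Re(iu) = κ(2 Re u). -/
theorem smul_add_star_eps_comb (a b w : ℂ) :
    w • (a • eps + b • realAct Li (star eps)) +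
      star w • star (a • eps + b • realAct Li (star eps)) =
    toC (w.re • spin a b + w.im • kap (spin a b)) := by
  rw [eps_comb]
  ext k
  fin_cases k <;> apply Complex.ext <;> simp [toC, spin, kap_apply] <;> ring

theorem eps_comb_eq_zero_iff (a b : ℂ) :
    a • eps + b • realAct Li (star eps) = 0 ↔ spin a b = 0 := by
  rw [eps_comb]
  constructor
  · intro h
    have h0 : a = 0 := by simpa using congrFun h 0
    have h1 : b = 0 := by simpa using congrFun h 1
    ext k
    fin_cases k <;> simp [spin, h0, h1]
  · intro h
    have h0 := congrArg (fun v : E4 => v 0) h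
    have h1 := congrArg (fun v : E4 => v 1) h
    have h2 := congrArg (fun v : E4 => v 2) h
    have h3 := congrArg (fun v : E4 => v 3) h
    simp [spin] at h0 h1 h2 h3
    have ha : a = 0 := Complex.ext h0 h2
    have hb : b = 0 := Complex.ext h1 h3
    ext k
    fin_cases k <;> simp [ha, hb]

/-- The pointwise form of the second equation, in real terms. -/
theorem dirac_pointwise_iff (a b ax ay bx by' : ℂ) (p q : ℝ) :
    ((1 / 2 : ℂ) • ((ax • eps + bx • realAct Li (star eps)) +
        Complex.I • (ay • eps + by' • realAct Li (star eps))) =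
      ((1 / 2 : ℂ) * ((1 / 2) * ((p : ℂ) - Complex.I * (q : ℂ)))) •
        realAct Li (star (a • eps + b • realAct Li (star eps)))) ↔
    spin ay by' - kap (spin ax bx) =
      (1 / 2 : ℝ) • J (p • kap (spin a b) - q • spin a b) := by
  simp only [eps_comb]
  constructor
  · intro h
    -- Both sides lie in the span of ε and L_i ε̄, so the first two coordinates carry all the
    -- information.
    have h0 := congrFun h 0
    have h1 := congrFun h 1
    simp [realAct, Li, Matrix.mulVec, dotProduct, Fin.sum_univ_four] at h0 h1
    have h0r := congrArg Complex.re h0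
    have h0i := congrArg Complex.im h0
    have h1r := congrArg Complex.re h1
    have h1i := congrArg Complex.im h1
    simp at h0r h0i h1r h1i
    ext k
    fin_cases k <;> simp [spin, kap_apply, J_apply] <;> linarith
  · intro h
    have h0 := congrArg (fun v : E4 => v 0) h
    have h1 := congrArg (fun v : E4 => v 1) h
    have h2 := congrArg (fun v : E4 => v 2) h
    have h3 := congrArg (fun v : E4 => v 3) h
    simp [spin, kap_apply, J_apply] at h0 h1 h2 h3
    ext k
    fin_cases k <;> apply Complex.ext <;>
      simp [realAct, Li, Matrix.mulVec, dotProduct, Fin.sum_univ_four] <;> linarith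

/-! ### Partial derivatives and the Laplacian of a map with given angle -/

section Calculus

variable {F : Type*} [NormedAddCommGroup F] [NormedSpace ℝ F]

theorem fderiv_apply_eq_dx_dy (f : ℂ → F) (z w : ℂ) :
    fderiv ℝ f z w = w.re • dx f z + w.im • dy f z := by
  have h : w = w.re • (1 : ℂ) + w.im • Complex.I := by
    simp [Complex.re_add_im]
  conv_lhs => rw [h]
  rw [map_add, map_smul, map_smul]; rfl

theorem fderiv_apply_contDiffAt {f : ℂ → F} {z : ℂ} (hf : ContDiffAt ℝ ∞ f z) (v : ℂ) :
    ContDiffAt ℝ ∞ (fun y => fderiv ℝ f y v) z :=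
  (hf.fderiv_right (m := ∞) (by simp)).clm_apply contDiffAt_const

theorem dx_contDiffAt {f : ℂ → F} {z : ℂ} (hf : ContDiffAt ℝ ∞ f z) : ContDiffAt ℝ ∞ (dx f) z :=
  fderiv_apply_contDiffAt hf 1

theorem dy_contDiffAt {f : ℂ → F} {z : ℂ} (hf : ContDiffAt ℝ ∞ f z) : ContDiffAt ℝ ∞ (dy f) z :=
  fderiv_apply_contDiffAt hf Complex.I

/-- The domain is general because the symmetry is needed on ℂ and also on ℝ × ℂ, where it exchanges
a time derivative with a space derivative. -/
theorem fderiv_fderiv_apply_comm {E F : Type*} [NormedAddCommGroup E] [NormedSpace ℝ E]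
    [NormedAddCommGroup F] [NormedSpace ℝ F] {f : E → F} {p : E} (hf : ContDiffAt ℝ ∞ f p)
    (v w : E) :
    fderiv ℝ (fun y => fderiv ℝ f y v) p w = fderiv ℝ (fun y => fderiv ℝ f y w) p v := by
  have h1 : DifferentiableAt ℝ (fderiv ℝ f) p :=
    (hf.fderiv_right (m := ∞) (by simp)).differentiableAt (by simp)
  have key (v w : E) : fderiv ℝ (fun y => fderiv ℝ f y v) p w = fderiv ℝ (fderiv ℝ f) p w v := by
    rw [fderiv_clm_apply h1 (by fun_prop)]; simp
  have hs : IsSymmSndFDerivAt ℝ f p := hf.isSymmSndFDerivAt (by simp; exact ENat.LEInfty.out)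
  rw [key, key]
  exact hs _ _

theorem dx_dy_comm {f : ℂ → F} {z : ℂ} (hf : ContDiffAt ℝ ∞ f z) :
    dx (dy f) z = dy (dx f) z :=
  fderiv_fderiv_apply_comm hf _ _

end Calculus

/-- The derivative of `rot (c β) ∘ v`. -/
theorem fderiv_rot_apply {β : ℂ → ℝ} {v : ℂ → E4} {z : ℂ} (hβ : DifferentiableAt ℝ β z)
    (hv : DifferentiableAt ℝ v z) (w : ℂ) :
    fderiv ℝ (fun y => rot (β y) (v y)) z w =
      rot (β z) (fderiv ℝ v z w) + fderiv ℝ β z w • J (rot (β z) (v z)) := by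
  have h : HasFDerivAt (fun y => Real.cos (β y) • v y + Real.sin (β y) • JL (v y)) _ z :=
    (hβ.hasFDerivAt.cos.smul hv.hasFDerivAt).add
      (hβ.hasFDerivAt.sin.smul (JL.hasFDerivAt.comp z hv.hasFDerivAt))
  have h2 : (fun y => rot (β y) (v y)) = fun y => Real.cos (β y) • v y + Real.sin (β y) • JL (v y) := by
    ext1 y; rw [rot_apply]; rfl
  rw [h2, h.fderiv]
  simp only [rot_apply, map_add, map_smul, J_J]
  simp [-map_add, -map_smul]
  module

theorem contDiffAt_rot_apply {β : ℂ → ℝ} {v : ℂ → E4} {z : ℂ} (hβ : ContDiffAt ℝ ∞ β z)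
    (hv : ContDiffAt ℝ ∞ v z) : ContDiffAt ℝ ∞ (fun y => rot (β y) (v y)) z := by
  have h2 : (fun y => rot (β y) (v y)) = fun y => Real.cos (β y) • v y + Real.sin (β y) • JL (v y) := by
    ext1 y; rw [rot_apply]; rfl
  rw [h2]
  exact (hβ.cos.smul hv).add (hβ.sin.smul (JL.contDiff.contDiffAt.comp z hv))

theorem fderiv_clm_comp {G : Type*} [NormedAddCommGroup G] [NormedSpace ℝ G] (L : E4 →L[ℝ] G)
    {v : ℂ → E4} {z : ℂ} (hv : DifferentiableAt ℝ v z) (w : ℂ) :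
    fderiv ℝ (fun y => L (v y)) z w = L (fderiv ℝ v z w) := by
  have := (L.hasFDerivAt.comp z hv.hasFDerivAt).fderiv
  change fderiv ℝ (L ∘ v) z w = _
  rw [this]; rfl

/-- The Laplacian of a weakly conformal Lagrangian map with angle `β` is `J dX(∇β)`. -/
theorem laplacian_of_angle {Ω : Set ℂ} (hΩ : IsOpen Ω) {β : ℂ → ℝ} {X : ℂ → E4}
    (hβ : ContDiffOn ℝ ∞ β Ω) (hX : ContDiffOn ℝ ∞ X Ω)
    (h : ∀ z ∈ Ω, dy X z = rot (β z) (kap (dx X z))) {z : ℂ} (hz : z ∈ Ω) :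
    dx (dx X) z + dy (dy X) z = J (dx β z • dx X z + dy β z • dy X z) := by
  have hXz := hX.contDiffAt (hΩ.mem_nhds hz)
  have hβz := (hβ.contDiffAt (hΩ.mem_nhds hz)).differentiableAt (by simp)
  have hdx : DifferentiableAt ℝ (dx X) z := (dx_contDiffAt hXz).differentiableAt (by simp)
  have hdy : DifferentiableAt ℝ (dy X) z := (dy_contDiffAt hXz).differentiableAt (by simp)
  -- R = e^{βJ} κ has square -1, so X_y = R X_x also reads X_x = -R X_y. Differentiating both, the
  -- terms R X_xy and -R X_xy cancel in the Laplacian and only the derivatives of β remain.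
  have sq (t : ℝ) (v : E4) : rot t (kap (rot t (kap v))) = - v := by
    rw [kap_rot, rot_rot_neg, kap_kap]
  have h' : ∀ y ∈ Ω, dx X y = rot (β y) (- kap (dy X y)) := by
    intro y hy
    rw [h y hy, map_neg, sq, neg_neg]
  have e1 : dy (dy X) z = rot (β z) (kap (dy (dx X) z)) + dy β z • J (dy X z) := by
    have : dy X =ᶠ[nhds z] fun y => rot (β y) (kap (dx X y)) :=
      Filter.eventually_of_mem (hΩ.mem_nhds hz) h
    rw [show dy (dy X) z = fderiv ℝ (dy X) z Complex.I from rfl, this.fderiv_eq,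
      fderiv_rot_apply (v := fun y => kap (dx X y)) hβz (kap.differentiableAt.comp z hdx), fderiv_clm_comp kap hdx, ← h z hz]
    rfl
  have e2 : dx (dx X) z = rot (β z) (-kap (dx (dy X) z)) + dx β z • J (dx X z) := by
    have : dx X =ᶠ[nhds z] fun y => rot (β y) ((-kap) (dy X y)) :=
      Filter.eventually_of_mem (hΩ.mem_nhds hz) h'
    rw [show dx (dx X) z = fderiv ℝ (dx X) z 1 from rfl, this.fderiv_eq,
      fderiv_rot_apply (v := fun y => (-kap) (dy X y)) hβz ((-kap).differentiableAt.comp z hdy), fderiv_clm_comp (-kap) hdy]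
    rw [show rot (β z) ((-kap) (dy X z)) = dx X z from (h' z hz).symm]
    rfl
  rw [e1, e2, dx_dy_comm hXz]
  simp only [map_add, map_smul, map_neg]
  module

/-! ### Primitives on simply connected domains -/

open Set Filter Topology MeasureTheory

/-- On a simply connected space, a cocycle of locally constant differences `f j - f i`, for
functions `f i` on an open cover, is a coboundary. -/
theorem exists_glue_of_locally_constant_sub {B G : Type*} [TopologicalSpace B]
    [SimplyConnectedSpace B] [LocallyPathConnectedSpace B] [AddCommGroup G]
    (U : B → Set B) (hU : ∀ i, IsOpen (U i)) (hmem : ∀ i, i ∈ U i) (f : B → B → G)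
    (hf : ∀ i j x, x ∈ U i → x ∈ U j → ∀ᶠ y in 𝓝 x, f i y - f j y = f i x - f j x) :
    ∃ g : B → G, ∀ i x, x ∈ U i → ∀ᶠ y in 𝓝 x, g y - f i y = g x - f i x := by
  -- With G discrete, local constancy of the differences is exactly continuity of the transition
  -- functions, and the resulting bundle is a covering. Simple connectivity of B then provides a
  -- global section.
  let : TopologicalSpace G := ⊥
  have : DiscreteTopology G := ⟨rfl⟩
  let Z : FiberBundleCore B B G :=
    { baseSet := U
      isOpen_baseSet := hU
      indexAt := id
      mem_baseSet_at := hmem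
      coordChange := fun i j x v => v + (f i x - f j x)
      coordChange_self := by intro i x _ v; simp
      continuousOn_coordChange := by
        intro i j
        have h1 : ContinuousOn (fun x => f i x - f j x) (U i ∩ U j) := fun x hx =>
          (continuousAt_const.congr (EventuallyEq.symm (hf i j x hx.1 hx.2))).continuousWithinAt
        exact continuousOn_snd.add (h1.comp continuousOn_fst fun p hp => hp.1)
      coordChange_comp := by intro i j k x _ v; abel }
  have cov : IsCoveringMap (Bundle.TotalSpace.proj : Bundle.TotalSpace G Z.Fiber → B) :=
    FiberBundle.isCoveringMap
  obtain ⟨b₀⟩ := (inferInstance : Nonempty B)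
  obtain ⟨s, ⟨-, hs⟩, -⟩ := cov.existsUnique_continuousMap_lifts (ContinuousMap.id B) b₀
    (⟨b₀, (0 : G)⟩ : Bundle.TotalSpace G Z.Fiber) rfl
  have hs' (x : B) : (s x).1 = x := congrFun hs x
  -- The section is recorded at x in the chart of index x. Read in chart i, it equals g - f i and is
  -- continuous into a discrete space, hence locally constant.
  refine ⟨fun x => f (s x).1 x + (show G from (s x).2), ?_⟩
  intro i x hx
  have hc : ContinuousAt (fun y => ((Z.localTriv i) (s y)).2) x := by
    have h1 : ContinuousAt (Z.localTriv i) (s x) :=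
      (Z.localTriv i).continuousAt (by
        rw [Bundle.Trivialization.mem_source]
        change (s x).1 ∈ U i
        rwa [hs'])
    exact (h1.comp s.continuous.continuousAt).snd
  have hloc : ∀ᶠ y in 𝓝 x, ((Z.localTriv i) (s y)).2 = ((Z.localTriv i) (s x)).2 :=
    (hc.eventually (p := fun v => v = ((Z.localTriv i) (s x)).2)
      (by rw [nhds_discrete]; exact rfl))
  have hval (y : B) : f (s y).1 y + (show G from (s y).2) - f i y = ((Z.localTriv i) (s y)).2 := by
    have : ((Z.localTriv i) (s y)).2 = (show G from (s y).2) + (f (s y).1 (s y).1 - f i (s y).1) := rfl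
    rw [this, show f i (s y).1 = f i y by rw [hs'],
      show f (s y).1 (s y).1 = f (s y).1 y from congrArg (f (s y).1) (hs' y)]
    abel
  filter_upwards [hloc] with y hy
  rw [hval, hval, hy]

/-- The Poincaré lemma for 1-forms on a simply connected domain. -/
theorem exists_primitive_of_simplyConnected {E F : Type*} [NormedAddCommGroup E] [NormedSpace ℝ E]
    [NormedAddCommGroup F] [NormedSpace ℝ F] [CompleteSpace F] {Ω : Set E} (hΩ : IsOpen Ω)
    (hsc : SimplyConnectedSpace Ω) {η : E → E →L[ℝ] F} (hη : DifferentiableOn ℝ η Ω)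
    (hsymm : ∀ a ∈ Ω, ∀ x y, fderiv ℝ η a x y = fderiv ℝ η a y x) :
    ∃ g : E → F, ∀ a ∈ Ω, HasFDerivAt g (η a) a := by
  classical
  have hloc (i : Ω) : ∃ r > 0, Metric.ball (i : E) r ⊆ Ω ∧
      ∃ f : E → F, ∀ a ∈ Metric.ball (i : E) r, HasFDerivAt f (η a) a := by
    obtain ⟨r, hr, hrΩ⟩ := Metric.isOpen_iff.1 hΩ i i.2
    exact ⟨r, hr, hrΩ, (convex_ball _ _).exists_forall_hasFDerivAt_of_fderiv_symmetric
      Metric.isOpen_ball (hη.mono hrΩ) fun a ha => hsymm a (hrΩ ha)⟩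
  choose r hr hrΩ f hf using hloc
  have : LocallyPathConnectedSpace Ω := hΩ.locallyPathConnectedSpace
  have sub_const {f₁ f₂ : E → F} {S : Set E} (hS : IsOpen S) {x : E} (hx : x ∈ S)
      (h₁ : ∀ a ∈ S, HasFDerivAt f₁ (η a) a) (h₂ : ∀ a ∈ S, HasFDerivAt f₂ (η a) a) :
      ∀ᶠ y in 𝓝 x, f₁ y - f₂ y = f₁ x - f₂ x := by
    obtain ⟨ρ, hρ, hρS⟩ := Metric.isOpen_iff.1 hS x hx
    filter_upwards [Metric.ball_mem_nhds x hρ] with y hy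
    have hd (a : E) (ha : a ∈ Metric.ball x ρ) :
        HasFDerivAt (fun y => f₁ y - f₂ y) (0 : E →L[ℝ] F) a := by
      simpa using (h₁ a (hρS ha)).fun_sub (h₂ a (hρS ha))
    exact (convex_ball x ρ).is_const_of_fderivWithin_eq_zero (𝕜 := ℝ)
      (fun a ha => (hd a ha).differentiableAt.differentiableWithinAt)
      (fun a ha => by
        rw [fderivWithin_of_isOpen Metric.isOpen_ball ha, (hd a ha).fderiv])
      hy (Metric.mem_ball_self hρ)
  obtain ⟨g, hg⟩ := exists_glue_of_locally_constant_sub (B := Ω) (G := F)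
    (fun i => Subtype.val ⁻¹' Metric.ball (i : E) (r i))
    (fun i => Metric.isOpen_ball.preimage continuous_subtype_val)
    (fun i => Metric.mem_ball_self (hr i)) (fun i x => f i x) (by
      intro i j x hi hj
      have := sub_const (Metric.isOpen_ball.inter Metric.isOpen_ball) (show (x : E) ∈ _ from ⟨hi, hj⟩)
        (fun a ha => hf i a ha.1) (fun a ha => hf j a ha.2)
      exact continuous_subtype_val.continuousAt.eventually this)
  refine ⟨fun x => if hx : x ∈ Ω then g ⟨x, hx⟩ else 0, ?_⟩
  intro a ha
  have h1 := hg ⟨a, ha⟩ ⟨a, ha⟩ (Metric.mem_ball_self (hr _))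
  have h2 := hf ⟨a, ha⟩ a (Metric.mem_ball_self (hr _))
  rw [nhds_subtype_eq_comap, eventually_comap] at h1
  refine (h2.add_const (g ⟨a, ha⟩ - f ⟨a, ha⟩ a)).congr_of_eventuallyEq ?_
  filter_upwards [h1, hΩ.mem_nhds ha] with y hy hyΩ
  rw [dif_pos hyΩ, ← hy ⟨y, hyΩ⟩ rfl]
  abel

/-! ### First variation of area -/

/-- A derivative integrates to zero over a compact set off which the function vanishes. -/
theorem setIntegral_fderiv_eq_zero {U K : Set ℂ} (hU : IsOpen U) (hK : IsCompact K) (hKU : K ⊆ U)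
    {q : ℂ → ℝ} (hq : ContDiffOn ℝ 1 q U) (h0 : ∀ z ∈ U, z ∉ K → q z = 0) (v : ℂ) :
    ∫ z in K, fderiv ℝ q z v = 0 := by
  classical
  -- Extension by zero: it agrees with q on all of U because q vanishes on U \ K, and it vanishes
  -- near each point off the closed set K, so it is C¹ on ℂ.
  set p : ℂ → ℝ := K.indicator q with hp
  have hpU : ∀ z ∈ U, p =ᶠ[𝓝 z] q := by
    intro z hz
    filter_upwards [hU.mem_nhds hz] with y hy
    by_cases hyK : y ∈ K
    · simp [hp, hyK]
    · simp [hp, hyK, h0 y hy hyK]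
  have hpK : ∀ z ∉ K, p =ᶠ[𝓝 z] fun _ => 0 := by
    intro z hz
    filter_upwards [hK.isClosed.isOpen_compl.mem_nhds hz] with y hy
    exact indicator_of_notMem hy _
  have hsmooth : ContDiff ℝ 1 p := by
    rw [contDiff_iff_contDiffAt]
    intro z
    by_cases hz : z ∈ K
    · exact (hq.contDiffAt (hU.mem_nhds (hKU hz))).congr_of_eventuallyEq (hpU z (hKU hz))
    · exact contDiffAt_const.congr_of_eventuallyEq (hpK z hz)
  have hcs : HasCompactSupport p := HasCompactSupport.intro hK fun z hz => indicator_of_notMem hz _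
  have hcs' : HasCompactSupport fun z => fderiv ℝ p z v :=
    HasCompactSupport.intro hK fun z hz => by rw [(hpK z hz).fderiv_eq]; simp
  have hcont : Continuous fun z => fderiv ℝ p z v :=
    (hsmooth.continuous_fderiv (by simp)).clm_apply continuous_const
  have hint : ∫ z, fderiv ℝ p z v = 0 := by
    have := integral_mul_fderiv_eq_neg_fderiv_mul_of_integrable (μ := (volume : Measure ℂ))
      (f := fun _ => (1 : ℝ)) (g := p) (v := v) (by simp)
      (by simpa using hcont.integrable_of_hasCompactSupport hcs')
      (by simpa using hsmooth.continuous.integrable_of_hasCompactSupport hcs)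
      (fun _ _ => differentiableAt_const _)
      (fun z _ => (hsmooth.differentiable (by simp)) z)
    simpa using this
  rw [← hint, ← setIntegral_eq_integral_of_forall_compl_eq_zero (s := K)
    (f := fun z => fderiv ℝ p z v)   (fun z hz => by rw [(hpK z hz).fderiv_eq]; simp)]
  exact setIntegral_congr_fun hK.measurableSet fun z hz => by
    rw [(hpU z (hKU hz)).fderiv_eq]

/-- Differentiation under the integral sign over a compact set. -/
theorem hasDerivAt_setIntegral_of_contDiffOn {K : Set ℂ} (hK : IsCompact K) {O : Set (ℝ × ℂ)}
    (hO : IsOpen O) (hKO : ∀ z ∈ K, ((0 : ℝ), z) ∈ O) {G : ℝ × ℂ → ℝ} (hG : ContDiffOn ℝ 1 G O) :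
    HasDerivAt (fun t => ∫ z in K, G (t, z)) (∫ z in K, fderiv ℝ G (0, z) (1, 0)) 0 := by
  -- The tube lemma gives one time interval valid for all z in K, hence one bound M for the time
  -- derivative.
  obtain ⟨u, v, hu, hv, h0u, hKv, huv⟩ := generalized_tube_lemma
    (isCompact_singleton (x := (0 : ℝ))) hK hO (by
      rintro ⟨t, z⟩ ⟨ht, hz⟩
      rw [mem_singleton_iff] at ht
      subst ht
      exact hKO z hz)
  obtain ⟨ε, hε, hεu⟩ := Metric.nhds_basis_closedBall.mem_iff.1 (hu.mem_nhds (h0u rfl))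
  have hCO : Metric.closedBall (0 : ℝ) ε ×ˢ K ⊆ O := (prod_mono hεu hKv).trans huv
  have hfd : ContinuousOn (fun p => fderiv ℝ G p (1, 0)) O :=
    (hG.continuousOn_fderiv_of_isOpen hO le_rfl).clm_apply continuousOn_const
  obtain ⟨M, hM⟩ := ((isCompact_closedBall (0 : ℝ) ε).prod hK).exists_bound_of_continuousOn
    (hfd.mono hCO)
  have hball : Metric.ball (0 : ℝ) ε ∈ 𝓝 (0 : ℝ) := Metric.ball_mem_nhds _ hε
  have hslice (t : ℝ) (ht : t ∈ Metric.closedBall (0 : ℝ) ε) {H : ℝ × ℂ → ℝ}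
      (hH : ContinuousOn H O) : ContinuousOn (fun z => H (t, z)) K :=
    hH.comp (by fun_prop) fun z hz => hCO ⟨ht, hz⟩
  have h0 : (0 : ℝ) ∈ Metric.closedBall (0 : ℝ) ε := Metric.mem_closedBall_self hε.le
  refine (hasDerivAt_integral_of_dominated_loc_of_deriv_le (μ := volume.restrict K)
    (F := fun t z => G (t, z)) (F' := fun t z => fderiv ℝ G (t, z) (1, 0)) (bound := fun _ => M)
    hball ?_ ?_ ?_ ?_ ?_ ?_).2
  · filter_upwards [hball] with t ht
    exact (hslice t (Metric.ball_subset_closedBall ht) hG.continuousOn).aestronglyMeasurable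
      hK.measurableSet
  · exact (hslice 0 h0 hG.continuousOn).integrableOn_compact hK
  · exact (hslice 0 h0 hfd).aestronglyMeasurable hK.measurableSet
  · filter_upwards [ae_restrict_mem hK.measurableSet] with z hz t ht
    exact hM (t, z) ⟨Metric.ball_subset_closedBall ht, hz⟩
  · exact (continuousOn_const).integrableOn_compact hK
  · filter_upwards [ae_restrict_mem hK.measurableSet] with z hz t ht
    have hp : (t, z) ∈ O := hCO ⟨Metric.ball_subset_closedBall ht, hz⟩
    have h1 : HasFDerivAt G (fderiv ℝ G (t, z)) (t, z) :=
      ((hG.contDiffAt (hO.mem_nhds hp)).differentiableAt (by simp)).hasFDerivAt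
    exact h1.comp_hasDerivAt t ((hasDerivAt_id t).prodMk (hasDerivAt_const t z))

/-- The first variation of the area of a conformal immersion. -/
theorem hasDerivAt_area {U K : Set ℂ} (hU : IsOpen U) (hK : IsCompact K) (hKU : K ⊆ U)
    {X : ℂ → E4} (hX : ContDiffOn ℝ ∞ X U) (hne : ∀ z ∈ U, dx X z ≠ 0)
    (hconf : IsWeaklyConformal U X) {V : E4 → E4} {Φ : ℝ → E4 → E4} (hΦ : IsDeformation V Φ) :
    HasDerivAt (fun t => area K (fun z => Φ t (X z)))
      (∫ z in K, (inner ℝ (dx X z) (dx (fun y => V (X y)) z) +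
        inner ℝ (dy X z) (dy (fun y => V (X y)) z))) 0 := by
  set Ψ : ℝ × ℂ → E4 := fun p => Φ p.1 (X p.2) with hΨ
  have hS : IsOpen ((univ : Set ℝ) ×ˢ U) := isOpen_univ.prod hU
  have hΨs : ContDiffOn ℝ ∞ Ψ (univ ×ˢ U) :=
    hΦ.smooth.comp_contDiffOn (contDiffOn_fst.prodMk (hX.comp contDiffOn_snd fun p hp => hp.2))
  have hΨat (t : ℝ) {z : ℂ} (hz : z ∈ U) : ContDiffAt ℝ ∞ Ψ (t, z) :=
    hΨs.contDiffAt (hS.mem_nhds ⟨mem_univ _, hz⟩)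
  have hslice (t : ℝ) {z : ℂ} (hz : z ∈ U) (w : ℂ) :
      fderiv ℝ (fun y => Φ t (X y)) z w = fderiv ℝ Ψ (t, z) (0, w) := by
    have h1 : HasFDerivAt Ψ (fderiv ℝ Ψ (t, z)) (t, z) :=
      ((hΨat t hz).differentiableAt (by simp)).hasFDerivAt
    have h2 := h1.comp z ((hasFDerivAt_const t z).prodMk (hasFDerivAt_id z))
    change fderiv ℝ (Ψ ∘ fun y => (t, y)) z w = _
    rw [HasFDerivAt.fderiv h2]
    simp
  have hzero : (fun y => Φ 0 (X y)) = X := funext fun y => hΦ.zero _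
  have hder (v : ℝ × ℂ) : ContDiffOn ℝ ∞ (fun p => fderiv ℝ Ψ p v) (univ ×ˢ U) :=
    (hΨs.fderiv_of_isOpen hS (by simp)).clm_apply contDiffOn_const
  set A : ℝ × ℂ → E4 := fun p => fderiv ℝ Ψ p (0, 1) with hA
  set B : ℝ × ℂ → E4 := fun p => fderiv ℝ Ψ p (0, Complex.I) with hB
  set E : ℝ × ℂ → ℝ := fun p => ‖A p‖ ^ 2 * ‖B p‖ ^ 2 - (inner ℝ (A p) (B p)) ^ 2 with hE
  have hEs : ContDiffOn ℝ ∞ E (univ ×ˢ U) :=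
    (((hder _).norm_sq ℝ).mul ((hder _).norm_sq ℝ)).sub (((hder _).inner ℝ (hder _)).pow 2)
  have hA0 {z : ℂ} (hz : z ∈ U) : A (0, z) = dx X z := by
    rw [hA, ← hzero]; exact (hslice 0 hz 1).symm
  have hB0 {z : ℂ} (hz : z ∈ U) : B (0, z) = dy X z := by
    rw [hB, ← hzero]; exact (hslice 0 hz Complex.I).symm
  have hE0 {z : ℂ} (hz : z ∈ U) : E (0, z) = (‖dx X z‖ ^ 2) ^ 2 := by
    have h := hconf z hz
    simp only [hE, hA0 hz, hB0 hz, ← h.1, h.2]; ring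
  have hpos {z : ℂ} (hz : z ∈ U) : 0 < ‖dx X z‖ ^ 2 := pow_pos (norm_pos_iff.2 (hne z hz)) 2
  -- The Gram determinant E equals |X_x|⁴ > 0 at t = 0; O is the open set where it stays positive
  -- and its square root is smooth.
  set O : Set (ℝ × ℂ) := (univ ×ˢ U) ∩ E ⁻¹' Ioi 0 with hOdef
  have hO : IsOpen O := hEs.continuousOn.isOpen_inter_preimage hS isOpen_Ioi
  have hUO {z : ℂ} (hz : z ∈ U) : ((0 : ℝ), z) ∈ O :=
    ⟨⟨mem_univ _, hz⟩, by rw [mem_preimage, hE0 hz]; exact pow_pos (hpos hz) 2⟩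
  have hG : ContDiffOn ℝ 1 (fun p => Real.sqrt (E p)) O :=
    ((hEs.mono inter_subset_left).of_le (by simp)).sqrt fun p hp => (ne_of_gt hp.2)
  have main := hasDerivAt_setIntegral_of_contDiffOn hK hO (fun z hz => hUO (hKU hz)) hG
  have harea : (fun t => area K (fun z => Φ t (X z))) =
      fun t => ∫ z in K, Real.sqrt (E (t, z)) := by
    ext t
    refine setIntegral_congr_fun hK.measurableSet fun z hz => ?_
    simp only [hE, hA, hB, dx, dy, hslice t (hKU hz)]
  rw [harea]
  convert main using 1
  refine setIntegral_congr_fun hK.measurableSet fun z hz => ?_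
  have hzU := hKU hz
  -- Time and space derivatives of Ψ commute, and the time derivative at t = 0 is V ∘ X.
  have hmixed (w : ℂ) : fderiv ℝ (fun p => fderiv ℝ Ψ p (0, w)) (0, z) (1, 0) =
      fderiv ℝ (fun y => V (X y)) z w := by
    rw [fderiv_fderiv_apply_comm (hΨat 0 hzU)]
    have hev : (fun y => V (X y)) =ᶠ[𝓝 z] fun y => fderiv ℝ Ψ (0, y) (1, 0) := by
      filter_upwards [hU.mem_nhds hzU] with y hy
      have h1 : HasFDerivAt Ψ (fderiv ℝ Ψ (0, y)) (0, y) :=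
        ((hΨat 0 hy).differentiableAt (by simp)).hasFDerivAt
      have h2 :=
        h1.comp_hasDerivAt (0 : ℝ) ((hasDerivAt_id (0 : ℝ)).prodMk (hasDerivAt_const (0 : ℝ) y))
      exact (hΦ.velocity (X y)).unique h2
    rw [hev.fderiv_eq]
    have h3 : DifferentiableAt ℝ (fun p => fderiv ℝ Ψ p (1, 0)) (0, z) :=
      ((hder (1, 0)).contDiffAt (hS.mem_nhds ⟨mem_univ _, hzU⟩)).differentiableAt (by simp)
    have h4 := h3.hasFDerivAt.comp z ((hasFDerivAt_const (0 : ℝ) z).prodMk (hasFDerivAt_id z))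
    have h5 : fderiv ℝ (fun y => fderiv ℝ Ψ (0, y) (1, 0)) z = _ := HasFDerivAt.fderiv h4
    rw [h5]
    simp
  have hline (v : ℝ × ℂ) : HasDerivAt (fun t => fderiv ℝ Ψ (t, z) v)
      (fderiv ℝ (fun p => fderiv ℝ Ψ p v) (0, z) (1, 0)) 0 := by
    have h3 : DifferentiableAt ℝ (fun p => fderiv ℝ Ψ p v) (0, z) :=
      ((hder v).contDiffAt (hS.mem_nhds ⟨mem_univ _, hzU⟩)).differentiableAt (by simp)
    exact h3.hasFDerivAt.comp_hasDerivAt (0 : ℝ)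
      ((hasDerivAt_id (0 : ℝ)).prodMk (hasDerivAt_const (0 : ℝ) z))
  have hAd : HasDerivAt (fun t => A (t, z)) (dx (fun y => V (X y)) z) 0 := by
    have := hline (0, 1); rwa [hmixed] at this
  have hBd : HasDerivAt (fun t => B (t, z)) (dy (fun y => V (X y)) z) 0 := by
    have := hline (0, Complex.I); rwa [hmixed] at this
  have hEd : HasDerivAt (fun t => E (t, z)) _ 0 :=
    ((hAd.norm_sq).mul (hBd.norm_sq)).sub ((hAd.inner ℝ hBd).pow 2)
  have hsd := hEd.sqrt (by rw [hE0 hzU]; exact ne_of_gt (pow_pos (hpos hzU) 2))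
  have hG1 : HasFDerivAt (fun p => Real.sqrt (E p)) (fderiv ℝ (fun p => Real.sqrt (E p)) (0, z))
      (0, z) :=
    ((hG.contDiffAt (hO.mem_nhds (hUO hzU))).differentiableAt (by simp)).hasFDerivAt
  have hG2 := hG1.comp_hasDerivAt (0 : ℝ)
    ((hasDerivAt_id (0 : ℝ)).prodMk (hasDerivAt_const (0 : ℝ) z))
  have huniq := hsd.unique hG2
  rw [← huniq, hE0 hzU, Real.sqrt_sq (hpos hzU).le, hA0 hzU, hB0 hzU, ← (hconf z hzU).1,
    (hconf z hzU).2]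
  have := norm_ne_zero_iff.2 (hne z hzU)
  field_simp
  ring

/-! ### Hamiltonian variations and harmonicity of the angle -/

theorem laplacian_eq_dx_dx_add_dy_dy {β : ℂ → ℝ} {z : ℂ} (hβ : ContDiffAt ℝ ∞ β z) :
    Laplacian.laplacian β z = dx (dx β) z + dy (dy β) z := by
  have h1 : DifferentiableAt ℝ (fderiv ℝ β) z :=
    (hβ.fderiv_right (m := ∞) (by simp)).differentiableAt (by simp)
  have key (v w : ℂ) : fderiv ℝ (fun y => fderiv ℝ β y v) z w = fderiv ℝ (fderiv ℝ β) z w v := by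
    rw [fderiv_clm_apply h1 (by fun_prop)]; simp
  rw [InnerProductSpace.laplacian_eq_iteratedFDeriv_complexPlane]
  simp only [iteratedFDeriv_two_apply]
  change _ = fderiv ℝ (fun y => fderiv ℝ β y 1) z 1 +
    fderiv ℝ (fun y => fderiv ℝ β y Complex.I) z Complex.I
  rw [key, key]
  rfl

theorem Lin1.contDiffOn {Ω : Set ℂ} {β : ℂ → ℝ} (h : Lin1 Ω β) : ContDiffOn ℝ ∞ β Ω :=
  fun z hz => (HarmonicAt.analyticAt (h z hz)).contDiffAt.contDiffWithinAt

theorem Lin1.laplacian_eq_zero {Ω : Set ℂ} {β : ℂ → ℝ} (h : Lin1 Ω β) {z : ℂ} (hz : z ∈ Ω) :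
    dx (dx β) z + dy (dy β) z = 0 := by
  rw [← laplacian_eq_dx_dx_add_dy_dy (HarmonicAt.analyticAt (h z hz)).contDiffAt]
  exact (h z hz).2.self_of_nhds

theorem lin1_of_laplacian_eq_zero {Ω : Set ℂ} (hΩ : IsOpen Ω) {β : ℂ → ℝ}
    (hβ : ContDiffOn ℝ ∞ β Ω) (h : ∀ z ∈ Ω, dx (dx β) z + dy (dy β) z = 0) : Lin1 Ω β := by
  intro z hz
  refine ⟨(hβ.contDiffAt (hΩ.mem_nhds hz)).of_le ENat.LEInfty.out, ?_⟩
  filter_upwards [hΩ.mem_nhds hz] with y hy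
  rw [laplacian_eq_dx_dx_add_dy_dy (hβ.contDiffAt (hΩ.mem_nhds hy))]
  exact h y hy

theorem contDiff_hamiltonianField {h : E4 → ℝ} (hh : ContDiff ℝ ∞ h) :
    ContDiff ℝ ∞ (hamiltonianField h) := by
  have h1 : ContDiff ℝ ∞ (gradient h) :=
    (InnerProductSpace.toDual ℝ E4).symm.contDiff.comp (hh.fderiv_right (m := ∞) (by simp))
  exact (JL.contDiff.comp h1).neg

/-- The first variation of area in a Hamiltonian direction, for a conformal Lagrangian immersion
with angle `β`, is the integral of `-h Δβ`. -/
theorem hasDerivAt_area_hamiltonian {Ω U : Set ℂ} (hΩ : IsOpen Ω) {β : ℂ → ℝ} {X : ℂ → E4}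
    (hβ : ContDiffOn ℝ ∞ β Ω) (hX : ContDiffOn ℝ ∞ X Ω)
    (hang : ∀ z ∈ Ω, dy X z = rot (β z) (kap (dx X z))) (hU : IsOpen U) (hUΩ : U ⊆ Ω)
    (hne : ∀ z ∈ U, dx X z ≠ 0) {h : E4 → ℝ} (hh : ContDiff ℝ ∞ h)
    (hK : IsCompact {z ∈ U | X z ∈ tsupport h}) {Φ : ℝ → E4 → E4}
    (hΦ : IsDeformation (hamiltonianField h) Φ) :
    HasDerivAt (fun t => area {z ∈ U | X z ∈ tsupport h} (fun z => Φ t (X z)))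
      (- ∫ z in {z ∈ U | X z ∈ tsupport h}, h (X z) * (dx (dx β) z + dy (dy β) z)) 0 := by
  set K := {z ∈ U | X z ∈ tsupport h} with hKdef
  have hKU : K ⊆ U := fun z hz => hz.1
  have hconf : IsWeaklyConformal U X := fun z hz =>
    let c := (conformal_lagrangian_angle_iff _ _ _).2 (hang z (hUΩ hz))
    ⟨c.1, c.2.1⟩
  have main := hasDerivAt_area hU hK hKU (hX.mono hUΩ) hne hconf hΦ
  convert main using 1
  have hV := contDiff_hamiltonianField hh
  have hXat {z : ℂ} (hz : z ∈ U) : ContDiffAt ℝ ∞ X z := hX.contDiffAt (hΩ.mem_nhds (hUΩ hz))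
  have hβat {z : ℂ} (hz : z ∈ U) : ContDiffAt ℝ ∞ β z := hβ.contDiffAt (hΩ.mem_nhds (hUΩ hz))
  have hVX {z : ℂ} (hz : z ∈ U) : ContDiffAt ℝ ∞ (fun y => hamiltonianField h (X y)) z :=
    hV.contDiffAt.comp z (hXat hz)
  have hhX {z : ℂ} (hz : z ∈ U) : ContDiffAt ℝ ∞ (fun y => h (X y)) z :=
    hh.contDiffAt.comp z (hXat hz)
  -- This field performs both integrations by parts at once. In its divergence ⟨ΔX, -J∇h⟩ =
  -- -⟨dX(∇β), ∇h⟩ cancels ⟨∇(h∘X), ∇β⟩, which leaves the first variation integrand plus (h∘X) Δβ.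
  set q : ℂ → ℂ → ℝ := fun v y =>
    inner ℝ (fderiv ℝ X y v) (hamiltonianField h (X y)) + h (X y) * fderiv ℝ β y v with hq
  have hqs (v : ℂ) {z : ℂ} (hz : z ∈ U) : ContDiffAt ℝ ∞ (q v) z :=
    ((fderiv_apply_contDiffAt (hXat hz) v).inner ℝ (hVX hz)).add
      ((hhX hz).mul (fderiv_apply_contDiffAt (hβat hz) v))
  have hq0 (v : ℂ) : ∀ z ∈ U, z ∉ K → q v z = 0 := by
    intro z hz hzK
    have hzs : X z ∉ tsupport h := fun hc => hzK ⟨hz, hc⟩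
    have hgrad : gradient h (X z) = 0 := by
      simp [gradient, fderiv_of_notMem_tsupport ℝ hzs]
    simp [hq, hamiltonianField, hgrad, image_eq_zero_of_notMem_tsupport hzs]
  have hqint (v : ℂ) : ∫ z in K, fderiv ℝ (q v) z v = 0 :=
    setIntegral_fderiv_eq_zero hU hK hKU
      (fun z hz => ((hqs v hz).of_le (by simp)).contDiffWithinAt) (hq0 v) v
  have hqd (v : ℂ) {z : ℂ} (hz : z ∈ U) : fderiv ℝ (q v) z v =
      (inner ℝ (fderiv ℝ X z v) (fderiv ℝ (fun y => hamiltonianField h (X y)) z v) +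
        inner ℝ (fderiv ℝ (fun y => fderiv ℝ X y v) z v) (hamiltonianField h (X z))) +
      (h (X z) * fderiv ℝ (fun y => fderiv ℝ β y v) z v +
        inner ℝ (gradient h (X z)) (fderiv ℝ X z v) * fderiv ℝ β z v) := by
    have hhd : HasFDerivAt (fun y => h (X y)) ((fderiv ℝ h (X z)).comp (fderiv ℝ X z)) z :=
      (hh.differentiable (by simp) (X z)).hasFDerivAt.comp z
        ((hXat hz).differentiableAt (by simp)).hasFDerivAt
    have h1 : DifferentiableAt ℝ (fun y => fderiv ℝ X y v) z :=
      (fderiv_apply_contDiffAt (hXat hz) v).differentiableAt (by simp)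
    have h2 : DifferentiableAt ℝ (fun y => fderiv ℝ β y v) z :=
      (fderiv_apply_contDiffAt (hβat hz) v).differentiableAt (by simp)
    have h3 : DifferentiableAt ℝ (fun y => hamiltonianField h (X y)) z :=
      (hVX hz).differentiableAt (by simp)
    have h4 : HasFDerivAt (q v) _ z := (h1.hasFDerivAt.inner ℝ h3.hasFDerivAt).add
      (hhd.mul h2.hasFDerivAt)
    rw [h4.fderiv]
    simp
    ring
  have hcont (v : ℂ) : ContinuousOn (fun z => fderiv ℝ (q v) z v) K := fun z hz =>
    (fderiv_apply_contDiffAt (hqs v (hKU hz)) v).continuousAt.continuousWithinAt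
  have hlap : ContinuousOn (fun z => h (X z) * (dx (dx β) z + dy (dy β) z)) K := fun z hz =>
    ((hhX (hKU hz)).mul ((dx_contDiffAt (dx_contDiffAt (hβat (hKU hz)))).add
      (dy_contDiffAt (dy_contDiffAt (hβat (hKU hz)))))).continuousAt.continuousWithinAt
  have hsplit : ∀ z ∈ K, (inner ℝ (dx X z) (dx (fun y => hamiltonianField h (X y)) z) +
        inner ℝ (dy X z) (dy (fun y => hamiltonianField h (X y)) z)) =
      (fderiv ℝ (q 1) z 1 + fderiv ℝ (q Complex.I) z Complex.I) -
        h (X z) * (dx (dx β) z + dy (dy β) z) := by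
    intro z hz
    have hzU := hKU hz
    have e1 : fderiv ℝ (q 1) z 1 =
        (inner ℝ (dx X z) (dx (fun y => hamiltonianField h (X y)) z) +
          inner ℝ (dx (dx X) z) (hamiltonianField h (X z))) +
        (h (X z) * dx (dx β) z + inner ℝ (gradient h (X z)) (dx X z) * dx β z) := hqd 1 hzU
    have e2 : fderiv ℝ (q Complex.I) z Complex.I =
        (inner ℝ (dy X z) (dy (fun y => hamiltonianField h (X y)) z) +
          inner ℝ (dy (dy X) z) (hamiltonianField h (X z))) +
        (h (X z) * dy (dy β) z + inner ℝ (gradient h (X z)) (dy X z) * dy β z) :=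
      hqd Complex.I hzU
    rw [e1, e2]
    have hL := laplacian_of_angle hΩ hβ hX hang (hUΩ hzU)
    have h1 : inner ℝ (dx (dx X) z) (hamiltonianField h (X z)) +
        inner ℝ (dy (dy X) z) (hamiltonianField h (X z)) =
        - (dx β z * inner ℝ (gradient h (X z)) (dx X z) +
          dy β z * inner ℝ (gradient h (X z)) (dy X z)) := by
      rw [← inner_add_left, hL, hamiltonianField, inner_neg_right, inner_J_J, real_inner_comm,
        inner_add_right, real_inner_smul_right, real_inner_smul_right]
    linarith
  rw [setIntegral_congr_fun hK.measurableSet hsplit, integral_sub, integral_add, hqint, hqint]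
  · simp
  · exact (hcont 1).integrableOn_compact hK
  · exact (hcont Complex.I).integrableOn_compact hK
  · exact ((hcont 1).add (hcont Complex.I)).integrableOn_compact hK
  · exact hlap.integrableOn_compact hK

/-- A separate Ω' is allowed because weakly conformal solutions are tested only where the
differential does not vanish. -/
theorem isHamiltonianStationary_of_harmonic {Ω Ω' : Set ℂ} (hΩ : IsOpen Ω) {β : ℂ → ℝ} {X : ℂ → E4}
    (hβ : Lin1 Ω β) (hX : ContDiffOn ℝ ∞ X Ω)
    (hang : ∀ z ∈ Ω, dy X z = rot (β z) (kap (dx X z))) (hΩ' : Ω' ⊆ Ω)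
    (hne : ∀ z ∈ Ω', dx X z ≠ 0) : IsHamiltonianStationary Ω' X := by
  intro h hh _ U hU hUΩ hK Φ hΦ
  have := hasDerivAt_area_hamiltonian hΩ hβ.contDiffOn hX hang hU (hUΩ.trans hΩ')
    (fun z hz => hne z (hUΩ hz)) hh hK hΦ
  rwa [setIntegral_congr_fun (g := fun _ => (0 : ℝ)) hK.measurableSet (fun z hz => by
    simp [hβ.laplacian_eq_zero (hΩ' (hUΩ hz.1))]), integral_zero, neg_zero] at this

/-- Only the initial velocity enters the first variation, so straight lines can replace the flow. -/
theorem isDeformation_add_smul {V : E4 → E4} (hV : ContDiff ℝ ∞ V) :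
    IsDeformation V (fun t x => x + t • V x) where
  smooth := contDiff_snd.add (contDiff_fst.smul (hV.comp contDiff_snd))
  zero := by simp
  velocity := fun x => by
    simpa using ((hasDerivAt_id (0 : ℝ)).smul_const (V x)).const_add x

/-- If Δβ(z₀) ≠ 0, it keeps its sign on a small disc. An immersion is locally injective at z₀, so a
bump at X(z₀) pulls back to a compact part of that disc, and the first variation -∫ (h∘X) Δβ cannot
vanish. -/
theorem harmonic_of_isHamiltonianStationary {Ω : Set ℂ} (hΩ : IsOpen Ω) {β : ℂ → ℝ} {X : ℂ → E4}
    (hβ : ContDiffOn ℝ ∞ β Ω) (hX : ContDiffOn ℝ ∞ X Ω)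
    (hang : ∀ z ∈ Ω, dy X z = rot (β z) (kap (dx X z)))
    (himm : ∀ z ∈ Ω, Function.Injective (fderiv ℝ X z)) (hstat : IsHamiltonianStationary Ω X) :
    Lin1 Ω β := by
  refine lin1_of_laplacian_eq_zero hΩ hβ fun z₀ hz₀ => ?_
  by_contra hlap
  set l : ℂ → ℝ := fun z => dx (dx β) z + dy (dy β) z with hl
  have hlc : ContinuousOn l Ω := fun z hz =>
    ((dx_contDiffAt (dx_contDiffAt (hβ.contDiffAt (hΩ.mem_nhds hz)))).add
      (dy_contDiffAt (dy_contDiffAt (hβ.contDiffAt (hΩ.mem_nhds hz))))).continuousAt.continuousWithinAt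
  -- The factor `l z₀` treats both signs of Δβ(z₀) together.
  have hsign : ∀ᶠ z in 𝓝 z₀, 0 < l z₀ * l z :=
    (continuousAt_const.mul (hlc.continuousAt (hΩ.mem_nhds hz₀))).eventually
      (lt_mem_nhds (mul_self_pos.2 hlap))
  have hXat : HasFDerivAt X (fderiv ℝ X z₀) z₀ :=
    ((hX.contDiffAt (hΩ.mem_nhds hz₀)).differentiableAt (by simp)).hasFDerivAt
  have hisol : ∀ᶠ z in 𝓝 z₀, z ≠ z₀ → X z ≠ X z₀ := by
    obtain ⟨C, -, hC⟩ := (fderiv ℝ X z₀ : ℂ →ₗ[ℝ] E4).exists_antilipschitzWith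
      (LinearMap.ker_eq_bot.2 (himm z₀ hz₀))
    exact eventually_nhdsWithin_iff.1 (hXat.eventually_ne ⟨C, hC⟩)
  obtain ⟨ρ, hρ, hball⟩ := Metric.nhds_basis_closedBall.eventually_iff.1
    (Filter.Eventually.and (p := fun z => z ∈ Ω) (hΩ.mem_nhds hz₀) (hsign.and hisol))
  have hBΩ : Metric.closedBall z₀ ρ ⊆ Ω := fun z hz => (hball hz).1
  have hXB : ContinuousOn X (Metric.closedBall z₀ ρ) := hX.continuousOn.mono hBΩ
  obtain ⟨m, hm, hmle⟩ : ∃ m > 0, ∀ z ∈ Metric.sphere z₀ ρ, m ≤ dist (X z) (X z₀) := by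
    have hne : (Metric.sphere z₀ ρ).Nonempty := NormedSpace.sphere_nonempty.2 hρ.le
    obtain ⟨w, hw, hwm⟩ := (isCompact_sphere z₀ ρ).exists_isMinOn hne
      ((continuous_id.dist (continuous_const (y := X z₀))).comp_continuousOn
        (hXB.mono Metric.sphere_subset_closedBall))
    refine ⟨dist (X w) (X z₀), dist_pos.2 ?_, fun z hz => hwm hz⟩
    refine (hball (Metric.sphere_subset_closedBall hw)).2.2 ?_
    rintro rfl
    simp at hw
    exact hρ.ne hw
  -- X maps the boundary circle to distance at least m from X(z₀). The outer radius m/2 keeps the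
  -- preimage of the support off that circle, so it is compact in the open disc.
  let b : ContDiffBump (X z₀) := ⟨m / 4, m / 2, by positivity, by linarith⟩
  set U := Metric.ball z₀ ρ with hU
  have hUB : U ⊆ Metric.closedBall z₀ ρ := Metric.ball_subset_closedBall
  have hKeq : {z ∈ U | X z ∈ tsupport b} =
      Metric.closedBall z₀ ρ ∩ X ⁻¹' Metric.closedBall (X z₀) (m / 2) := by
    ext z
    rw [b.tsupport_eq]
    constructor
    · rintro ⟨hz, hzX⟩
      exact ⟨hUB hz, hzX⟩
    · rintro ⟨hz, hzX⟩
      refine ⟨?_, hzX⟩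
      rcases (Metric.mem_closedBall.1 hz).lt_or_eq with h | h
      · exact h
      · have h1 := hmle z h
        have h2 : dist (X z) (X z₀) ≤ m / 2 := hzX
        linarith
  have hK : IsCompact {z ∈ U | X z ∈ tsupport b} := by
    rw [hKeq]
    exact (isCompact_closedBall z₀ ρ).of_isClosed_subset
      (hXB.preimage_isClosed_of_isClosed Metric.isClosed_closedBall Metric.isClosed_closedBall)
      inter_subset_left
  have hdx : ∀ z ∈ U, dx X z ≠ 0 := fun z hz h0 => by
    have := himm z (hBΩ (hUB hz)) (h0.trans (map_zero (fderiv ℝ X z)).symm)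
    exact one_ne_zero this
  have hD := isDeformation_add_smul (contDiff_hamiltonianField (h := b) b.contDiff)
  have h1 := hasDerivAt_area_hamiltonian hΩ hβ hX hang Metric.isOpen_ball (hUB.trans hBΩ) hdx
    (h := b) b.contDiff hK hD
  have h2 := hstat b b.contDiff b.hasCompactSupport U Metric.isOpen_ball (hUB.trans hBΩ) hK _ hD
  have h3 : ∫ z in {z ∈ U | X z ∈ tsupport b}, b (X z) * (l z₀ * l z) = 0 := by
    have := h1.unique h2
    rw [neg_eq_zero] at this
    rw [← mul_zero (l z₀), ← this, ← integral_const_mul]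
    exact integral_congr_ae (ae_of_all _ fun z => by simp only [hl]; ring)
  have hpos : 0 < ∫ z in {z ∈ U | X z ∈ tsupport b}, b (X z) * (l z₀ * l z) := by
    rw [setIntegral_pos_iff_support_of_nonneg_ae]
    · have hopen : IsOpen (U ∩ X ⁻¹' Metric.ball (X z₀) (m / 2)) :=
        (hXB.mono hUB).isOpen_inter_preimage Metric.isOpen_ball Metric.isOpen_ball
      refine lt_of_lt_of_le (hopen.measure_pos volume ⟨z₀, Metric.mem_ball_self hρ,
        Metric.mem_ball_self (by positivity)⟩) (measure_mono ?_)
      rintro z ⟨hz, hzX⟩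
      refine ⟨?_, hz, ?_⟩
      · exact (mul_pos (b.pos_of_mem_ball hzX) (hball (hUB hz)).2.1).ne'
      · rw [b.tsupport_eq]
        exact Metric.ball_subset_closedBall hzX
    · filter_upwards [ae_restrict_mem hK.measurableSet] with z hz
      exact mul_nonneg b.nonneg (hball (hUB hz.1)).2.1.le
    · refine ContinuousOn.integrableOn_compact hK ?_
      have hsub : {z ∈ U | X z ∈ tsupport b} ⊆ Ω := fun z hz => hBΩ (hUB hz.1)
      exact (b.continuous.comp_continuousOn (hX.continuousOn.mono hsub)).mul
        (continuousOn_const.mul (hlc.mono hsub))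
  exact hpos.ne' h3

/-! ### Lagrangian angles -/

/-- A smooth function with values in the unit circle has a smooth argument on a simply connected
domain. -/
theorem exists_smooth_argument {Ω : Set ℂ} (hΩ : IsOpen Ω) (hsc : SimplyConnectedSpace Ω)
    {s : ℂ → ℂ} (hs : ContDiffOn ℝ ∞ s Ω) (hn : ∀ z ∈ Ω, ‖s z‖ = 1) :
    ∃ β : ℂ → ℝ, ContDiffOn ℝ ∞ β Ω ∧ ∀ z ∈ Ω, s z = Complex.exp (Complex.I * (β z : ℂ)) := by
  classical
  have : LocallyPathConnectedSpace Ω := hΩ.locallyPathConnectedSpace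
  let σ : C(Ω, Circle) := ⟨fun z => ⟨s z, mem_sphere_zero_iff_norm.2 (hn z z.2)⟩,
    (hs.continuousOn.domRestrict).subtype_mk _⟩
  obtain ⟨z₁⟩ := (inferInstance : Nonempty Ω)
  obtain ⟨b, ⟨-, hb⟩, -⟩ := Circle.isCoveringMap_exp.existsUnique_continuousMap_lifts σ z₁
    (Complex.arg (σ z₁)) (Circle.exp_arg _)
  set β : ℂ → ℝ := fun z => if hz : z ∈ Ω then b ⟨z, hz⟩ else 0 with hβ
  have hexp : ∀ z ∈ Ω, s z = Complex.exp (Complex.I * (β z : ℂ)) := by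
    intro z hz
    have h := congrArg (Subtype.val) (congrFun hb ⟨z, hz⟩)
    have h2 : ((Circle.exp (b ⟨z, hz⟩) : Circle) : ℂ) = s z := h
    rw [← h2, Circle.coe_exp, hβ]
    simp [hz, mul_comm]
  have hcont : ContinuousOn β Ω := by
    rw [continuousOn_iff_continuous_domRestrict]
    convert b.continuous using 1
    ext z
    simp [hβ]
  refine ⟨β, fun z₀ hz₀ => ContDiffAt.contDiffWithinAt ?_, hexp⟩
  have hne : s z₀ ≠ 0 := by rw [hexp z₀ hz₀]; exact Complex.exp_ne_zero _
  -- The quotient s(z)/s(z₀) is near 1, where the principal logarithm is smooth. As soon as |β(z) -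
  -- β(z₀)| < π, its imaginary part is exactly β(z) - β(z₀).
  have hsm : ContDiffAt ℝ ∞ (fun z => β z₀ + (Complex.log (s z / s z₀)).im) z₀ := by
    have h1 : ContDiffAt ℝ ∞ (fun z => s z / s z₀) z₀ := by
      simpa only [div_eq_mul_inv] using
        (hs.contDiffAt (hΩ.mem_nhds hz₀)).mul contDiffAt_const
    have h2 : ContDiffAt ℝ ∞ Complex.log (s z₀ / s z₀) := by
      rw [div_self hne]
      exact (Complex.contDiffAt_log Complex.one_mem_slitPlane).restrict_scalars ℝ
    have h3 : ContDiffAt ℝ ∞ (fun z => Complex.log (s z / s z₀)) z₀ :=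
      ContDiffAt.comp (g := Complex.log) (f := fun z => s z / s z₀) z₀ h2 h1
    exact contDiffAt_const.add (Complex.imCLM.contDiff.contDiffAt.comp z₀ h3)
  refine hsm.congr_of_eventuallyEq ?_
  have hnear : ∀ᶠ z in 𝓝 z₀, dist (β z) (β z₀) < Real.pi :=
    (hcont.continuousAt (hΩ.mem_nhds hz₀)).eventually (Metric.ball_mem_nhds _ Real.pi_pos)
  filter_upwards [hΩ.mem_nhds hz₀, hnear] with z hz hd
  rw [Real.dist_eq, abs_lt] at hd
  rw [hexp z hz, hexp z₀ hz₀, ← Complex.exp_sub, Complex.log_exp]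
  · simp
  · simpa using hd.1
  · simpa using hd.2.le

/-- The squared modulus of a complex 2×2 determinant is the Hermitian Gram determinant of its
columns, and the Hermitian product has real part ⟨a, b⟩ and imaginary part ±ω(a, b). -/
theorem norm_sq_dz1dz2 (a b : E4) :
    ‖dz1dz2 a b‖ ^ 2 = ‖a‖ ^ 2 * ‖b‖ ^ 2 - inner ℝ a b ^ 2 - omega a b ^ 2 := by
  rw [Complex.sq_norm, Complex.normSq_apply, norm_sq_E4, norm_sq_E4, omega, inner_E4, inner_E4]
  simp [dz1dz2, J_apply]
  ring

theorem contDiffAt_ofReal_coord {v : ℂ → E4} {z : ℂ} (hv : ContDiffAt ℝ ∞ v z) (k : Fin 4) :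
    ContDiffAt ℝ ∞ (fun y => ((v y k : ℝ) : ℂ)) z :=
  (Complex.ofRealCLM.comp (EuclideanSpace.proj k : E4 →L[ℝ] ℝ)).contDiff.contDiffAt.comp z hv

theorem contDiffAt_dz1dz2 {v w : ℂ → E4} {z : ℂ} (hv : ContDiffAt ℝ ∞ v z)
    (hw : ContDiffAt ℝ ∞ w z) : ContDiffAt ℝ ∞ (fun y => dz1dz2 (v y) (w y)) z := by
  have c := fun k => contDiffAt_ofReal_coord hv k
  have d := fun k => contDiffAt_ofReal_coord hw k
  have e : ContDiffAt ℝ ∞ (fun _ : ℂ => Complex.I) z := contDiffAt_const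
  exact (((c 0).add (e.mul (c 1))).mul ((d 2).add (e.mul (d 3)))).sub
    (((d 0).add (e.mul (d 1))).mul ((c 2).add (e.mul (c 3))))

/-- The weakly conformal Lagrangian maps with Lagrangian angle map `β`. -/
def HasAngle (Ω : Set ℂ) (β : ℂ → ℝ) (X : ℂ → E4) : Prop :=
  ContDiffOn ℝ ∞ X Ω ∧ ∀ z ∈ Ω, dy X z = rot (β z) (kap (dx X z))

theorem exists_hasAngle {Ω : Set ℂ} (hΩ : IsOpen Ω) (hsc : SimplyConnectedSpace Ω)
    {X : ℂ → E4} (hX : IsConformalLagrangianImmersion Ω X) :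
    ∃ β : ℂ → ℝ, ContDiffOn ℝ ∞ β Ω ∧ HasAngle Ω β X := by
  have hne : ∀ z ∈ Ω, dx X z ≠ 0 := fun z hz h0 =>
    one_ne_zero (hX.immersion z hz (h0.trans (map_zero (fderiv ℝ X z)).symm))
  have hXat {z : ℂ} (hz : z ∈ Ω) : ContDiffAt ℝ ∞ X z := hX.smooth.contDiffAt (hΩ.mem_nhds hz)
  have hpos : ∀ z ∈ Ω, ((‖dx X z‖ ^ 2 : ℝ) : ℂ) ≠ 0 := fun z hz =>
    Complex.ofReal_ne_zero.2 (pow_ne_zero 2 (norm_ne_zero_iff.2 (hne z hz)))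
  set s : ℂ → ℂ := fun z => dz1dz2 (dx X z) (dy X z) * ((‖dx X z‖ ^ 2 : ℝ) : ℂ)⁻¹ with hs
  have hsm : ContDiffOn ℝ ∞ s Ω := by
    intro z hz
    have h1 : ContDiffAt ℝ ∞ (fun y => ‖dx X y‖ ^ 2) z := (dx_contDiffAt (hXat hz)).norm_sq ℝ
    have h2 : ContDiffAt ℝ ∞ (fun y => ((‖dx X y‖ ^ 2 : ℝ) : ℂ)) z :=
      Complex.ofRealCLM.contDiff.contDiffAt.comp z h1
    have h3 : ContDiffAt ℝ ∞ (fun y => ((‖dx X y‖ ^ 2 : ℝ) : ℂ)⁻¹) z := h2.inv (hpos z hz)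
    exact ((contDiffAt_dz1dz2 (dx_contDiffAt (hXat hz))
      (dy_contDiffAt (hXat hz))).mul h3).contDiffWithinAt
  have hnorm : ∀ z ∈ Ω, ‖s z‖ = 1 := by
    intro z hz
    have h1 := norm_sq_dz1dz2 (dx X z) (dy X z)
    rw [(hX.conformal z hz).2, hX.lagrangian z hz, ← (hX.conformal z hz).1] at h1
    have h2 : ‖dz1dz2 (dx X z) (dy X z)‖ = ‖dx X z‖ ^ 2 := by
      rw [← sq_eq_sq₀ (norm_nonneg _) (by positivity), h1]; ring
    have h3 : ‖dx X z‖ ^ 2 ≠ 0 := pow_ne_zero 2 (norm_ne_zero_iff.2 (hne z hz))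
    rw [hs, norm_mul, norm_inv, Complex.norm_real, h2, Real.norm_of_nonneg (by positivity),
      mul_inv_cancel₀ h3]
  obtain ⟨β, hβ, hexp⟩ := exists_smooth_argument hΩ hsc hsm hnorm
  refine ⟨β, hβ, hX.smooth, fun z hz => ?_⟩
  refine (conformal_lagrangian_angle_iff _ _ _).1 ⟨(hX.conformal z hz).1, (hX.conformal z hz).2,
    hX.lagrangian z hz, ?_⟩
  rw [← (hX.conformal z hz).1, ← hexp z hz, ← Complex.ofReal_mul, ← pow_two, hs,
    mul_comm, mul_assoc, inv_mul_cancel₀ (hpos z hz), mul_one]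

theorem HasAngle.pointwise {Ω : Set ℂ} {β : ℂ → ℝ} {X : ℂ → E4} (h : HasAngle Ω β X) {z : ℂ}
    (hz : z ∈ Ω) : ‖dx X z‖ = ‖dy X z‖ ∧ inner ℝ (dx X z) (dy X z) = 0 ∧
      omega (dx X z) (dy X z) = 0 ∧ dz1dz2 (dx X z) (dy X z) =
        (‖dx X z‖ : ℂ) * (‖dy X z‖ : ℂ) * Complex.exp (Complex.I * (β z : ℂ)) :=
  (conformal_lagrangian_angle_iff _ _ _).2 (h.2 z hz)

/-- The pointwise conditions amount to the angle equation, and stationarity is then automatic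
because β is harmonic. Where dX ≠ 0, the angle equation forces X_x ≠ 0. -/
theorem isWeaklyConformalSolution_iff {Ω : Set ℂ} (hΩ : IsOpen Ω) {β : ℂ → ℝ} (hβ : Lin1 Ω β)
    {X : ℂ → E4} : IsWeaklyConformalSolution Ω β X ↔ HasAngle Ω β X := by
  constructor
  · intro h
    exact ⟨h.smooth, fun z hz => (conformal_lagrangian_angle_iff _ _ _).1
      ⟨(h.conformal z hz).1, (h.conformal z hz).2, h.lagrangian z hz, h.angle z hz⟩⟩
  · intro h
    refine ⟨h.1, fun z hz => ⟨(h.pointwise hz).1, (h.pointwise hz).2.1⟩,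
      fun z hz => (h.pointwise hz).2.2.1, fun z hz => (h.pointwise hz).2.2.2, ?_⟩
    refine isHamiltonianStationary_of_harmonic hΩ hβ h.1 h.2 (fun z hz => hz.1) ?_
    rintro z ⟨hz, hfd⟩ h0
    refine hfd (ContinuousLinearMap.ext fun w => ?_)
    rw [fderiv_apply_eq_dx_dy, h.2 z hz, h0]
    simp

/-! ### The spinor field of a map with prescribed angle -/

/-- `spin` as a linear map. -/
def spinL : ℂ × ℂ →L[ℝ] E4 := LinearMap.toContinuousLinearMap
  { toFun := fun p => spin p.1 p.2
    map_add' := by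
      intro v w; ext k; fin_cases k <;> simp [spin]; ring
    map_smul' := by
      intro c v; ext k; fin_cases k <;> simp [spin] }

theorem contDiffAt_spin {a b : ℂ → ℂ} {z : ℂ} (ha : ContDiffAt ℝ ∞ a z)
    (hb : ContDiffAt ℝ ∞ b z) : ContDiffAt ℝ ∞ (fun y => spin (a y) (b y)) z :=
  spinL.contDiff.contDiffAt.comp z (ha.prodMk hb)

theorem fderiv_spin {a b : ℂ → ℂ} {z : ℂ} (ha : DifferentiableAt ℝ a z)
    (hb : DifferentiableAt ℝ b z) (w : ℂ) :
    fderiv ℝ (fun y => spin (a y) (b y)) z w = spin (fderiv ℝ a z w) (fderiv ℝ b z w) := by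
  have h := spinL.hasFDerivAt.comp z (ha.hasFDerivAt.prodMk hb.hasFDerivAt)
  change fderiv ℝ (spinL ∘ fun y => (a y, b y)) z w = _
  rw [HasFDerivAt.fderiv h]
  rfl

theorem fderiv_eps_comb {a b : ℂ → ℂ} {z : ℂ} (ha : DifferentiableAt ℝ a z)
    (hb : DifferentiableAt ℝ b z) (w : ℂ) :
    fderiv ℝ (fun y => a y • eps + b y • realAct Li (star eps)) z w =
      fderiv ℝ a z w • eps + fderiv ℝ b z w • realAct Li (star eps) := by
  have h := (ha.hasFDerivAt.smul_const eps).add (hb.hasFDerivAt.smul_const (realAct Li (star eps)))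
  change fderiv ℝ ((fun y => a y • eps) + fun y => b y • realAct Li (star eps)) z w = _
  rw [h.fderiv]
  rfl

/-- The second equation says that the right hand side of the third one is closed. -/
theorem dzbar_eq_iff_closed {β : ℂ → ℝ} {a b : ℂ → ℂ} {u : ℂ → Fin 4 → ℂ} {z : ℂ}
    (hβ : ContDiffAt ℝ ∞ β z) (ha : ContDiffAt ℝ ∞ a z) (hb : ContDiffAt ℝ ∞ b z)
    (hu : u =ᶠ[𝓝 z] fun y => a y • eps + b y • realAct Li (star eps)) :
    dzbar u z = ((1 / 2 : ℂ) * dzReal β z) • realAct Li (star (u z)) ↔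
      dy (fun y => rot (β y / 2) (spin (a y) (b y))) z =
        dx (fun y => rot (β y / 2) (kap (spin (a y) (b y)))) z := by
  have ha' := ha.differentiableAt (by simp)
  have hb' := hb.differentiableAt (by simp)
  have hβ' := hβ.differentiableAt (by simp)
  have hs : DifferentiableAt ℝ (fun y => spin (a y) (b y)) z :=
    (contDiffAt_spin ha hb).differentiableAt (by simp)
  have hβ2 : DifferentiableAt ℝ (fun y => β y / 2) z := by
    simpa only [div_eq_mul_inv] using hβ'.mul_const (2 : ℝ)⁻¹
  have hdβ (w : ℂ) : fderiv ℝ (fun y => β y / 2) z w = fderiv ℝ β z w / 2 := by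
    simp only [div_eq_mul_inv]
    rw [(hβ'.hasFDerivAt.mul_const (2 : ℝ)⁻¹ : HasFDerivAt (fun y => β y * 2⁻¹) _ z).fderiv]
    simp [mul_comm]
  have e1 : dzbar u z = (1 / 2 : ℂ) •
      ((dx a z • eps + dx b z • realAct Li (star eps)) +
        Complex.I • (dy a z • eps + dy b z • realAct Li (star eps))) := by
    simp only [dzbar, dx, dy, hu.fderiv_eq, fderiv_eps_comb ha' hb']
  have e2 : dy (fun y => rot (β y / 2) (spin (a y) (b y))) z =
      rot (β z / 2) (spin (dy a z) (dy b z)) +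
        (dy β z / 2) • J (rot (β z / 2) (spin (a z) (b z))) := by
    rw [dy, fderiv_rot_apply (v := fun y => spin (a y) (b y)) hβ2 hs, fderiv_spin ha' hb', hdβ]
    rfl
  have e3 : dx (fun y => rot (β y / 2) (kap (spin (a y) (b y)))) z =
      rot (β z / 2) (kap (spin (dx a z) (dx b z))) +
        (dx β z / 2) • J (rot (β z / 2) (kap (spin (a z) (b z)))) := by
    rw [dx, fderiv_rot_apply (v := fun y => kap (spin (a y) (b y))) hβ2
      (kap.differentiableAt.comp z hs), fderiv_clm_comp kap hs, fderiv_spin ha' hb', hdβ]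
    rfl
  rw [e1, hu.self_of_nhds, dzReal, dirac_pointwise_iff, e2, e3, J_rot, J_rot,
    ← map_smul (rot _), ← map_smul (rot _), ← map_add (rot _), ← map_add (rot _)]
  have hinj : Function.Injective (rot (β z / 2)) := fun v w h => by
    rw [← rot_neg_rot (β z / 2) v, h, rot_neg_rot]
  rw [hinj.eq_iff, map_sub, map_smul, map_smul, ← sub_eq_zero,
    ← sub_eq_zero (b := kap (spin (dx a z) (dx b z)) + _)]
  refine Eq.congr ?_ rfl
  module

theorem lin3_pointwise_iff {β : ℝ} {a b : ℂ} {X : ℂ → E4} {z : ℂ} :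
    (∀ w : ℂ, (fun k => ((fderiv ℝ X z w) k : ℂ)) = realAct (NormedSpace.exp ((β / 2) • Li))
      (w • (a • eps + b • realAct Li (star eps)) +
        star w • star (a • eps + b • realAct Li (star eps)))) ↔
    dx X z = rot (β / 2) (spin a b) ∧ dy X z = rot (β / 2) (kap (spin a b)) := by
  simp only [smul_add_star_eps_comb, realAct_exp_toC]
  constructor
  · intro h
    have h1 := toC_injective (h 1)
    have h2 := toC_injective (h Complex.I)
    simp at h1 h2
    exact ⟨h1, h2⟩
  · rintro ⟨h1, h2⟩ w
    change toC _ = _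
    rw [fderiv_apply_eq_dx_dy, h1, h2, map_add, map_smul, map_smul]

/-- Both partial derivatives come from one vector v = 2 Re u, and e^{βJ} κ e^{βJ/2} v = e^{βJ/2} κ
v. -/
theorem hasAngle_of_lin3 {Ω : Set ℂ} {β : ℂ → ℝ} {u : ℂ → Fin 4 → ℂ} {X : ℂ → E4}
    (hu : IsSpinorField Ω u) (h : Lin3 Ω β u X) : HasAngle Ω β X := by
  obtain ⟨a, b, -, -, hab⟩ := hu
  refine ⟨h.1, fun z hz => ?_⟩
  have h3 := h.2 z hz
  rw [hab z hz] at h3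
  obtain ⟨h1, h2⟩ := lin3_pointwise_iff.1 h3
  rw [h1, h2, kap_rot, ← rot_add]
  congr 2
  ring

theorem exists_lin2_lin3 {Ω : Set ℂ} (hΩ : IsOpen Ω) {β : ℂ → ℝ} (hβ : ContDiffOn ℝ ∞ β Ω)
    {X : ℂ → E4} (hX : HasAngle Ω β X) : ∃ u, Lin2 Ω β u ∧ Lin3 Ω β u X := by
  -- Half of the angle is undone, and a, b are the coordinates that invert `spin`. Equation (2) for
  -- them is then the symmetry of the second derivatives of X.
  set v : ℂ → E4 := fun z => rot (-(β z / 2)) (dx X z) with hv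
  set a : ℂ → ℂ := fun z => ((v z 0 : ℝ) : ℂ) + ((v z 2 : ℝ) : ℂ) * Complex.I with ha
  set b : ℂ → ℂ := fun z => ((v z 1 : ℝ) : ℂ) - ((v z 3 : ℝ) : ℂ) * Complex.I with hb
  have hXat {z : ℂ} (hz : z ∈ Ω) : ContDiffAt ℝ ∞ X z := hX.1.contDiffAt (hΩ.mem_nhds hz)
  have hβat {z : ℂ} (hz : z ∈ Ω) : ContDiffAt ℝ ∞ β z := hβ.contDiffAt (hΩ.mem_nhds hz)
  have hvat {z : ℂ} (hz : z ∈ Ω) : ContDiffAt ℝ ∞ v z :=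
    contDiffAt_rot_apply ((hβat hz).div_const 2).neg (dx_contDiffAt (hXat hz))
  have haat {z : ℂ} (hz : z ∈ Ω) : ContDiffAt ℝ ∞ a z :=
    (contDiffAt_ofReal_coord (hvat hz) 0).add
      ((contDiffAt_ofReal_coord (hvat hz) 2).mul contDiffAt_const)
  have hbat {z : ℂ} (hz : z ∈ Ω) : ContDiffAt ℝ ∞ b z :=
    (contDiffAt_ofReal_coord (hvat hz) 1).sub
      ((contDiffAt_ofReal_coord (hvat hz) 3).mul contDiffAt_const)
  have hspin (z : ℂ) : spin (a z) (b z) = v z := by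
    ext k; fin_cases k <;> simp [spin, ha, hb]
  have h1 (z : ℂ) : dx X z = rot (β z / 2) (spin (a z) (b z)) := by
    rw [hspin, hv, rot_rot_neg]
  have h2 {z : ℂ} (hz : z ∈ Ω) : dy X z = rot (β z / 2) (kap (spin (a z) (b z))) := by
    rw [hX.2 z hz, h1 z, kap_rot, ← rot_add]
    congr 2
    ring
  refine ⟨fun z => a z • eps + b z • realAct Li (star eps), ⟨⟨a, b,
    fun z hz => (haat hz).contDiffWithinAt, fun z hz => (hbat hz).contDiffWithinAt,
    fun z _ => rfl⟩, fun z hz => ?_⟩, hX.1, fun z hz => lin3_pointwise_iff.2 ⟨h1 z, h2 hz⟩⟩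
  rw [dzbar_eq_iff_closed (hβat hz) (haat hz) (hbat hz) (Eventually.of_forall fun _ => rfl)]
  have e1 : (fun y => rot (β y / 2) (spin (a y) (b y))) = dx X := funext fun y => (h1 y).symm
  have e2 : (fun y => rot (β y / 2) (kap (spin (a y) (b y)))) =ᶠ[𝓝 z] dy X := by
    filter_upwards [hΩ.mem_nhds hz] with y hy
    exact (h2 hy).symm
  have e3 : dx (fun y => rot (β y / 2) (kap (spin (a y) (b y)))) z = dx (dy X) z := by
    rw [dx, e2.fderiv_eq]; rfl
  rw [e1, e3, dx_dy_comm (hXat hz)]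

theorem exists_lin3 {Ω : Set ℂ} (hΩ : IsOpen Ω) (hsc : SimplyConnectedSpace Ω) {β : ℂ → ℝ}
    {u : ℂ → Fin 4 → ℂ} (hβ : ContDiffOn ℝ ∞ β Ω) (hu : Lin2 Ω β u) (z₀ : ℂ) (p : E4) :
    ∃ X, Lin3 Ω β u X ∧ X z₀ = p := by
  obtain ⟨⟨a, b, ha, hb, hab⟩, h2⟩ := hu
  set P : ℂ → E4 := fun y => rot (β y / 2) (spin (a y) (b y)) with hP
  set Q : ℂ → E4 := fun y => rot (β y / 2) (kap (spin (a y) (b y))) with hQ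
  have hs {z : ℂ} (hz : z ∈ Ω) : ContDiffAt ℝ ∞ (fun y => spin (a y) (b y)) z :=
    contDiffAt_spin (ha.contDiffAt (hΩ.mem_nhds hz)) (hb.contDiffAt (hΩ.mem_nhds hz))
  have hβ2 {z : ℂ} (hz : z ∈ Ω) : ContDiffAt ℝ ∞ (fun y => β y / 2) z :=
    (hβ.contDiffAt (hΩ.mem_nhds hz)).div_const 2
  have hPs {z : ℂ} (hz : z ∈ Ω) : ContDiffAt ℝ ∞ P z := contDiffAt_rot_apply (hβ2 hz) (hs hz)
  have hQs {z : ℂ} (hz : z ∈ Ω) : ContDiffAt ℝ ∞ Q z :=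
    contDiffAt_rot_apply (hβ2 hz) (kap.contDiff.contDiffAt.comp z (hs hz))
  have hPQ {z : ℂ} (hz : z ∈ Ω) : dy P z = dx Q z :=
    (dzbar_eq_iff_closed (hβ.contDiffAt (hΩ.mem_nhds hz)) (ha.contDiffAt (hΩ.mem_nhds hz))
      (hb.contDiffAt (hΩ.mem_nhds hz)) (eventually_of_mem (hΩ.mem_nhds hz) hab)).1 (h2 z hz)
  let R₁ : E4 →L[ℝ] ℂ →L[ℝ] E4 := ContinuousLinearMap.smulRightL ℝ ℂ E4 Complex.reCLM
  let R₂ : E4 →L[ℝ] ℂ →L[ℝ] E4 := ContinuousLinearMap.smulRightL ℝ ℂ E4 Complex.imCLM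
  set η : ℂ → ℂ →L[ℝ] E4 := fun z => R₁ (P z) + R₂ (Q z) with hη
  have hη_apply (z w : ℂ) : η z w = w.re • P z + w.im • Q z := rfl
  have hηs : ContDiffOn ℝ ∞ η Ω := fun z hz =>
    ((R₁.contDiff.contDiffAt.comp z (hPs hz)).add
      (R₂.contDiff.contDiffAt.comp z (hQs hz))).contDiffWithinAt
  have hηd {z : ℂ} (hz : z ∈ Ω) (v w : ℂ) : fderiv ℝ η z v w =
      w.re • fderiv ℝ P z v + w.im • fderiv ℝ Q z v := by
    have h := (R₁.hasFDerivAt.comp z ((hPs hz).differentiableAt (by simp)).hasFDerivAt).add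
      (R₂.hasFDerivAt.comp z ((hQs hz).differentiableAt (by simp)).hasFDerivAt)
    have h' : fderiv ℝ η z = _ := HasFDerivAt.fderiv h
    rw [h']
    rfl
  obtain ⟨Y, hY⟩ := exists_primitive_of_simplyConnected hΩ hsc
    (hηs.differentiableOn (by simp)) (by
      intro z hz v w
      -- The antisymmetric part of dη is a multiple of P_y - Q_x, which vanishes by equation (2).
      rw [hηd hz, hηd hz, fderiv_apply_eq_dx_dy P, fderiv_apply_eq_dx_dy P,
        fderiv_apply_eq_dx_dy Q, fderiv_apply_eq_dx_dy Q, hPQ hz]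
      module)
  have hX : ∀ z ∈ Ω, HasFDerivAt (fun z => Y z + (p - Y z₀)) (η z) z := fun z hz =>
    (hY z hz).add_const _
  refine ⟨fun z => Y z + (p - Y z₀), ⟨?_, fun z hz => ?_⟩, by simp⟩
  · rw [show (∞ : WithTop ℕ∞) = ((⊤ : ℕ∞) : WithTop ℕ∞) from rfl,
      contDiffOn_infty_iff_fderiv_of_isOpen hΩ]
    exact ⟨fun z hz => (hX z hz).differentiableAt.differentiableWithinAt,
      hηs.congr fun z hz => (hX z hz).fderiv⟩
  · rw [hab z hz, lin3_pointwise_iff, dx, dy, (hX z hz).fderiv, hη_apply, hη_apply]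
    simp [hP, hQ]

/-! ### Symplectic isometries -/

/-- As ω(v, w) = ⟨Jv, w⟩, preserving both forms forces commutation with J. -/
theorem J_linearIsometryEquiv {g : E4 ≃ᵃⁱ[ℝ] E4} (hg : g ∈ symplecticIsometries) (v : E4) :
    g.linearIsometryEquiv (J v) = J (g.linearIsometryEquiv v) := by
  refine ext_inner_right ℝ fun w => ?_
  obtain ⟨w, rfl⟩ := g.linearIsometryEquiv.surjective w
  rw [LinearIsometryEquiv.inner_map_map]
  exact (hg v w).symm

/-- Symplectic isometries multiply the complex area form by a constant of modulus one. -/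
theorem exists_dz1dz2_linearIsometryEquiv {g : E4 ≃ᵃⁱ[ℝ] E4} (hg : g ∈ symplecticIsometries) :
    ∃ c : ℝ, ∀ v w : E4, dz1dz2 (g.linearIsometryEquiv v) (g.linearIsometryEquiv w) =
      Complex.exp (Complex.I * (c : ℂ)) * dz1dz2 v w := by
  set A := g.linearIsometryEquiv with hA
  set e : E4 := EuclideanSpace.single 0 1 with he
  set f : E4 := EuclideanSpace.single 2 1 with hf
  have hdec (v : E4) : v = v 0 • e + v 1 • J e + v 2 • f + v 3 • J f := by
    ext k; fin_cases k <;> simp [he, hf, J_apply]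
  have hAv (v : E4) : A v = v 0 • A e + v 1 • J (A e) + v 2 • A f + v 3 • J (A f) := by
    conv_lhs => rw [hdec v]
    simp only [map_add, map_smul, hA, J_linearIsometryEquiv hg]
  -- A is complex linear, so it multiplies the complex determinant by det A = `dz1dz2 (A e) (A f)`.
  have hD (v w : E4) : dz1dz2 (A v) (A w) = dz1dz2 (A e) (A f) * dz1dz2 v w := by
    rw [hAv v, hAv w]
    simp only [dz1dz2, J_apply]
    apply Complex.ext <;> simp <;> ring
  have hnorm : ‖dz1dz2 (A e) (A f)‖ = 1 := by
    have h := norm_sq_dz1dz2 (A e) (A f)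
    have h1 : omega (A e) (A f) = omega e f := hg e f
    rw [A.norm_map, A.norm_map, A.inner_map_map, h1] at h
    have h2 : ‖dz1dz2 (A e) (A f)‖ ^ 2 = 1 := by
      rw [h]; simp [he, hf, omega, inner_E4, J_apply]
    exact (pow_eq_one_iff_of_nonneg (norm_nonneg _) two_ne_zero).1 h2
  refine ⟨Complex.arg (dz1dz2 (A e) (A f)), fun v w => ?_⟩
  rw [hD, mul_comm Complex.I]
  congr 1
  conv_lhs => rw [← Complex.norm_mul_exp_arg_mul_I (dz1dz2 (A e) (A f)), hnorm]
  simp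

/-- The rotation `rot t` as a linear isometry. -/
def rotEquiv (t : ℝ) : E4 ≃ₗᵢ[ℝ] E4 where
  toFun := rot t
  invFun := rot (-t)
  left_inv := rot_neg_rot t
  right_inv := rot_rot_neg t
  map_add' := map_add _
  map_smul' := map_smul _
  norm_map' := norm_rot t

theorem exists_symplecticIsometry (t : ℝ) (p : E4) :
    ∃ g ∈ symplecticIsometries, ∀ x, g x = rot t x + p := by
  refine ⟨(rotEquiv t).toAffineIsometryEquiv.trans (AffineIsometryEquiv.constVAdd ℝ E4 p), ?_, ?_⟩
  · intro v w
    change omega (rot t v) (rot t w) = _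
    rw [omega, J_rot, inner_rot_rot, omega]
  · intro x
    change p + rot t x = _
    rw [add_comm]

theorem affineIsometryEquiv_apply (g : E4 ≃ᵃⁱ[ℝ] E4) (x : E4) :
    g x = g.linearIsometryEquiv x + g 0 := by
  simpa using g.map_vadd 0 x

/-! ### The vector space of maps with a given angle -/

/-- The angle equation involves only dX, so it suffices that L intertwines it up to the shift c.
Translations, scalings, rotations and symplectic isometries are all instances. -/
theorem HasAngle.comp_affine {Ω : Set ℂ} (hΩ : IsOpen Ω) {β : ℂ → ℝ} {X : ℂ → E4}
    (hX : HasAngle Ω β X) (L : E4 →L[ℝ] E4) (p : E4) (c : ℝ)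
    (hL : ∀ (a : E4) (θ : ℝ), L (rot θ (kap a)) = rot (θ + c) (kap (L a))) :
    HasAngle Ω (fun z => β z + c) (fun z => L (X z) + p) := by
  refine ⟨(L.contDiff.comp_contDiffOn hX.1).add contDiffOn_const, fun z hz => ?_⟩
  have hXz := (hX.1.contDiffAt (hΩ.mem_nhds hz)).differentiableAt (by simp)
  simp only [dx, dy, fderiv_add_const, fderiv_clm_comp L hXz]
  rw [← hL]
  exact congrArg L (hX.2 z hz)

theorem HasAngle.add_const {Ω : Set ℂ} (hΩ : IsOpen Ω) {β : ℂ → ℝ} {X : ℂ → E4}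
    (hX : HasAngle Ω β X) (p : E4) : HasAngle Ω β (fun z => X z + p) := by
  simpa using hX.comp_affine hΩ (ContinuousLinearMap.id ℝ E4) p 0 (by simp)

theorem HasAngle.const_smul {Ω : Set ℂ} (hΩ : IsOpen Ω) {β : ℂ → ℝ} {X : ℂ → E4}
    (hX : HasAngle Ω β X) (r : ℝ) : HasAngle Ω β (fun z => r • X z) := by
  simpa using hX.comp_affine hΩ (r • ContinuousLinearMap.id ℝ E4) 0 0 (by simp)

theorem HasAngle.add {Ω : Set ℂ} (hΩ : IsOpen Ω) {β : ℂ → ℝ} {X Y : ℂ → E4}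
    (hX : HasAngle Ω β X) (hY : HasAngle Ω β Y) : HasAngle Ω β (fun z => X z + Y z) := by
  refine ⟨hX.1.add hY.1, fun z hz => ?_⟩
  have hXz := (hX.1.contDiffAt (hΩ.mem_nhds hz)).differentiableAt (by simp)
  have hYz := (hY.1.contDiffAt (hΩ.mem_nhds hz)).differentiableAt (by simp)
  have h1 := hX.2 z hz
  have h2 := hY.2 z hz
  simp only [dx, dy] at h1 h2 ⊢
  rw [fderiv_fun_add hXz hYz, add_apply, add_apply, h1, h2, map_add, map_add]

/-- The shift is 2t because e^{tJ} acts on ℂ² as a scalar, with determinant e^{2it}. -/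
theorem HasAngle.rot {Ω : Set ℂ} (hΩ : IsOpen Ω) {β : ℂ → ℝ} {X : ℂ → E4}
    (hX : HasAngle Ω β X) (t : ℝ) (p : E4) :
    HasAngle Ω (fun z => β z + 2 * t) (fun z => HSL.rot t (X z) + p) :=
  hX.comp_affine hΩ (HSL.rot t) p (2 * t) fun a θ => by
    rw [kap_rot, ← rot_add, ← rot_add]
    congr 2
    ring

theorem HasAngle.comp_symplecticIsometry {Ω : Set ℂ} (hΩ : IsOpen Ω) {β : ℂ → ℝ} {X : ℂ → E4}
    (hX : HasAngle Ω β X) {g : E4 ≃ᵃⁱ[ℝ] E4} (hg : g ∈ symplecticIsometries) :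
    ∃ c : ℝ, HasAngle Ω (fun z => β z + c) (fun z => g (X z)) := by
  obtain ⟨c, hc⟩ := exists_dz1dz2_linearIsometryEquiv hg
  refine ⟨c, ?_⟩
  rw [show (fun z => g (X z)) = fun z => g.linearIsometryEquiv (X z) + g 0 from
    funext fun z => affineIsometryEquiv_apply g (X z)]
  refine hX.comp_affine hΩ (g.linearIsometryEquiv : E4 →L[ℝ] E4) (g 0) c fun a θ => ?_
  obtain ⟨h1, h2, h3, h4⟩ := (conformal_lagrangian_angle_iff a _ θ).2 rfl
  refine (conformal_lagrangian_angle_iff _ _ _).1 ⟨?_, ?_, ?_, ?_⟩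
  · simpa using h1
  · simpa using h2
  · exact (hg _ _).trans h3
  · change dz1dz2 (g.linearIsometryEquiv a) (g.linearIsometryEquiv _) =
      (‖g.linearIsometryEquiv a‖ : ℂ) * (‖g.linearIsometryEquiv _‖ : ℂ) * _
    rw [hc, h4, LinearIsometryEquiv.norm_map, LinearIsometryEquiv.norm_map, Complex.ofReal_add,
      mul_add, Complex.exp_add]
    ring

/-- The space of maps with angle `β` that vanish at `z₀`. -/
def angleSubmodule {Ω : Set ℂ} (hΩ : IsOpen Ω) (β : ℂ → ℝ) (z₀ : ℂ) : Submodule ℝ (Ω → E4) where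
  carrier := Ω.domRestrict '' {X : ℂ → E4 | X z₀ = 0 ∧ HasAngle Ω β X}
  zero_mem' := ⟨fun _ => 0, ⟨rfl, contDiffOn_const, fun z _ => by simp [dx, dy]⟩, rfl⟩
  add_mem' := by
    rintro _ _ ⟨X, ⟨hX0, hX⟩, rfl⟩ ⟨Y, ⟨hY0, hY⟩, rfl⟩
    exact ⟨fun z => X z + Y z, ⟨by simp [hX0, hY0], hX.add hΩ hY⟩, rfl⟩
  smul_mem' := by
    rintro r _ ⟨X, ⟨hX0, hX⟩, rfl⟩
    exact ⟨fun z => r • X z, ⟨by simp [hX0], hX.const_smul hΩ r⟩, rfl⟩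

theorem hasAngle_iff_exists_lin {Ω : Set ℂ} (hΩ : IsOpen Ω) {β : ℂ → ℝ} (hβ : Lin1 Ω β)
    {X : ℂ → E4} : HasAngle Ω β X ↔ ∃ u, Lin2 Ω β u ∧ Lin3 Ω β u X :=
  ⟨exists_lin2_lin3 hΩ hβ.contDiffOn, fun ⟨_, h2, h3⟩ => hasAngle_of_lin3 h2.1 h3⟩

theorem dx_ne_zero_of_lin3 {Ω : Set ℂ} {β : ℂ → ℝ} {u : ℂ → Fin 4 → ℂ} {X : ℂ → E4}
    (hu : IsSpinorField Ω u) (h : Lin3 Ω β u X) {z : ℂ} (hz : z ∈ Ω) :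
    dx X z ≠ 0 ↔ u z ≠ 0 := by
  obtain ⟨a, b, -, -, hab⟩ := hu
  have h3 := h.2 z hz
  rw [hab z hz] at h3 ⊢
  rw [not_iff_not, eps_comb_eq_zero_iff, (lin3_pointwise_iff.1 h3).1, ← norm_eq_zero, norm_rot,
    norm_eq_zero]

theorem HasAngle.isConformalLagrangianImmersion {Ω : Set ℂ} {β : ℂ → ℝ} {X : ℂ → E4}
    (hX : HasAngle Ω β X) (hne : ∀ z ∈ Ω, dx X z ≠ 0) : IsConformalLagrangianImmersion Ω X := by
  refine ⟨hX.1, fun z hz => ?_, fun z hz => ⟨(hX.pointwise hz).1, (hX.pointwise hz).2.1⟩,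
    fun z hz => (hX.pointwise hz).2.2.1⟩
  refine (injective_iff_map_eq_zero _).2 fun w hw => ?_
  rw [fderiv_apply_eq_dx_dy] at hw
  have hn : ‖dx X z‖ ^ 2 ≠ 0 := pow_ne_zero 2 (norm_ne_zero_iff.2 (hne z hz))
  have h2 := (hX.pointwise hz).2.1
  have hx := congrArg (fun v => inner ℝ (dx X z) v) hw
  have hy := congrArg (fun v => inner ℝ v (dy X z)) hw
  simp only [inner_add_right, inner_add_left, real_inner_smul_left, real_inner_smul_right, h2,
    real_inner_self_eq_norm_sq, inner_zero_left, inner_zero_right, ← (hX.pointwise hz).1,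
    mul_zero, add_zero, zero_add, mul_eq_zero, hn, or_false] at hx hy
  exact Complex.ext hx hy

theorem Lin1.add_const {Ω : Set ℂ} {β : ℂ → ℝ} (h : Lin1 Ω β) (c : ℝ) :
    Lin1 Ω (fun z => β z + c) :=
  InnerProductSpace.HarmonicOnNhd.add h (fun _ _ => InnerProductSpace.harmonicAt_const c)

end HSL

end

/-! ### The main theorem -/

theorem theorem3 (Ω : Set ℂ) (hΩ : IsOpen Ω) (hsc : SimplyConnectedSpace Ω) :
    -- the Hamiltonian stationary conformal Lagrangian immersions are the maps obtained from
    -- the three equations with `u` nowhere zero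
    (∀ X : ℂ → HSL.E4,
      (HSL.IsConformalLagrangianImmersion Ω X ∧ HSL.IsHamiltonianStationary Ω X) ↔
        ∃ (β : ℂ → ℝ) (u : ℂ → Fin 4 → ℂ),
          HSL.Lin1 Ω β ∧ HSL.Lin2 Ω β u ∧ HSL.Lin3 Ω β u X ∧ ∀ z ∈ Ω, u z ≠ 0) ∧
    -- the third equation can be solved for all solutions of the first two, uniquely once the
    -- value at a point is prescribed
    (∀ (β : ℂ → ℝ) (u : ℂ → Fin 4 → ℂ), HSL.Lin1 Ω β → HSL.Lin2 Ω β u →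
      ∀ z₀ ∈ Ω, ∀ p : HSL.E4,
        ∃ X : ℂ → HSL.E4, HSL.Lin3 Ω β u X ∧ X z₀ = p ∧
          ∀ Y : ℂ → HSL.E4, HSL.Lin3 Ω β u Y → Y z₀ = p → Set.EqOn X Y Ω) ∧
    -- the solutions of the system are the weakly conformal solutions with Lagrangian angle `β`
    (∀ β : ℂ → ℝ, HSL.Lin1 Ω β → ∀ X : ℂ → HSL.E4,
      HSL.IsWeaklyConformalSolution Ω β X ↔
        ∃ u : ℂ → Fin 4 → ℂ, HSL.Lin2 Ω β u ∧ HSL.Lin3 Ω β u X) ∧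
    -- for given `β` these form the orbit of a real vector space
    (∀ β : ℂ → ℝ, HSL.Lin1 Ω β → ∀ z₀ ∈ Ω,
      ∃ V : Submodule ℝ (Ω → HSL.E4),
        (V : Set (Ω → HSL.E4)) =
          Ω.domRestrict '' {X : ℂ → HSL.E4 | X z₀ = 0 ∧
            ∃ u : ℂ → Fin 4 → ℂ, HSL.Lin2 Ω β u ∧ HSL.Lin3 Ω β u X} ∧
        Ω.domRestrict '' {X : ℂ → HSL.E4 | HSL.IsWeaklyConformalSolution Ω β X} =
          {Y : Ω → HSL.E4 | ∃ p : HSL.E4, ∃ W ∈ V, ∀ z, Y z = W z + p} ∧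
        Ω.domRestrict '' {X : ℂ → HSL.E4 | ∃ c : ℝ,
            HSL.IsWeaklyConformalSolution Ω (fun z => β z + c) X} =
          {Y : Ω → HSL.E4 | ∃ g ∈ HSL.symplecticIsometries, ∃ W ∈ V, ∀ z, Y z = g (W z)}) := by
  open HSL in
  refine ⟨fun X => ⟨?_, ?_⟩, ?_, fun β hβ X => ?_, fun β hβ z₀ hz₀ => ?_⟩
  · rintro ⟨hX, hstat⟩
    obtain ⟨β, hβ, hang⟩ := exists_hasAngle hΩ hsc hX
    have hL : Lin1 Ω β :=
      harmonic_of_isHamiltonianStationary hΩ hβ hang.1 hang.2 hX.immersion hstat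
    obtain ⟨u, h2, h3⟩ := exists_lin2_lin3 hΩ hβ hang
    refine ⟨β, u, hL, h2, h3, fun z hz => (dx_ne_zero_of_lin3 h2.1 h3 hz).1 fun h0 => ?_⟩
    exact one_ne_zero (hX.immersion z hz (h0.trans (map_zero (fderiv ℝ X z)).symm))
  · rintro ⟨β, u, h1, h2, h3, hu⟩
    have hang := hasAngle_of_lin3 h2.1 h3
    have hne : ∀ z ∈ Ω, dx X z ≠ 0 := fun z hz => (dx_ne_zero_of_lin3 h2.1 h3 hz).2 (hu z hz)
    exact ⟨hang.isConformalLagrangianImmersion hne,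
      isHamiltonianStationary_of_harmonic hΩ h1 hang.1 hang.2 subset_rfl hne⟩
  · intro β u h1 h2 z₀ hz₀ p
    obtain ⟨X, hX, hXp⟩ := exists_lin3 hΩ hsc h1.contDiffOn h2 z₀ p
    refine ⟨X, hX, hXp, fun Y hY hYp => ?_⟩
    have hpre : IsPreconnected Ω := isPreconnected_iff_preconnectedSpace.2 inferInstance
    refine hΩ.eqOn_of_fderiv_eq hpre (hX.1.differentiableOn (by simp))
      (hY.1.differentiableOn (by simp)) (fun z hz => ?_) hz₀ (hXp.trans hYp.symm)
    exact ContinuousLinearMap.ext fun w =>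
      toC_injective ((hX.2 z hz w).trans (hY.2 z hz w).symm)
  · rw [isWeaklyConformalSolution_iff hΩ hβ, hasAngle_iff_exists_lin hΩ hβ]
  · have hmem (W : Ω → E4) : W ∈ angleSubmodule hΩ β z₀ ↔
        ∃ X : ℂ → E4, (X z₀ = 0 ∧ HasAngle Ω β X) ∧ Ω.domRestrict X = W := Iff.rfl
    refine ⟨angleSubmodule hΩ β z₀, ?_, ?_, ?_⟩
    · simp only [← hasAngle_iff_exists_lin hΩ hβ]
      rfl
    · ext Y
      simp only [isWeaklyConformalSolution_iff hΩ hβ]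
      constructor
      · rintro ⟨X, hX, rfl⟩
        exact ⟨X z₀, _, ⟨fun z => X z + -X z₀, ⟨by simp, hX.add_const hΩ _⟩, rfl⟩,
          fun z => by simp [Set.domRestrict]⟩
      · rintro ⟨p, W, hW, hY⟩
        obtain ⟨X, ⟨-, hX⟩, rfl⟩ := (hmem W).1 hW
        exact ⟨fun z => X z + p, hX.add_const hΩ p, funext fun z => (hY z).symm⟩
    · ext Y
      constructor
      · rintro ⟨X, ⟨c, hX⟩, rfl⟩
        rw [isWeaklyConformalSolution_iff hΩ (hβ.add_const c)] at hX
        -- Rotation by c/2 shifts the angle by c. The map e^{-cJ/2}(X - X(z₀)) has angle β and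
        -- vanishes at z₀, and g carries it back to X.
        obtain ⟨g, hg, hgx⟩ := exists_symplecticIsometry (c / 2) (X z₀)
        have hW := hX.rot hΩ (-(c / 2)) (-rot (-(c / 2)) (X z₀))
        have hβc : (fun z => β z + c + 2 * -(c / 2)) = β := by ext z; ring
        rw [hβc] at hW
        refine ⟨g, hg, _, ⟨_, ⟨?_, hW⟩, rfl⟩, fun z => ?_⟩
        · simp
        · simp [Set.domRestrict, hgx, rot_rot_neg]
      · rintro ⟨g, hg, W, hW, hY⟩
        obtain ⟨X, ⟨-, hX⟩, rfl⟩ := (hmem W).1 hW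
        obtain ⟨c, hc⟩ := hX.comp_symplecticIsometry hΩ hg
        exact ⟨fun z => g (X z), ⟨c, (isWeaklyConformalSolution_iff hΩ (hβ.add_const c)).2 hc⟩,
          funext fun z => (hY z).symm⟩
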